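/- Let $P\in\mathbb{C}[z]$ be a polynomial of degree $n\ge 1$, and let its harmonic web be $W=\{z\in\mathbb{C}:\Re P(z)=0\}\cup\{z\in\mathbb{C}:\Im P(z)=0\}$. A chord diagram is a finite simple graph without isolated vertices, embedded in the closed unit disc (vertices are points, edges are simple arcs meeting each other and the vertex set only in their end points), such that its leaves (vertices of valency one) lie on the boundary circle and everything else lies in the open disc; vertices that are not leaves are called inner nodes. The radial homeomorphism $h(z)=z/\sqrt{1+|z|^2}$ of $\mathbb{C}$ onto the open unit disc carries $W$ onto the part in the open disc of a chord diagram $D$ (that is, $D$ without its leaves), where each edge of $D$ comes from one of the two level sets $\Re P=0$, $\Im P=0$. Moreover $D$ can be chosen such that: - $D$ has no cycles, i.e. its graph is a forest; - $D$ has exactly $4n$ leaves, and if $P$ is monic these are exactly the $4n$-th roots of unity; - every inner node of $D$ has even valency; - for every zero $z$ of $P$, the point $h(z)$ is an inner node of $D$ of valency $4m$, where $m$ is the multiplicity of $z$; in particular it has valency $4$ if $z$ is a simple zero, and all zeros give nodes of valency $4$ if $P$ has $n$ distinct zeros. -/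

import Mathlib

open Polynomial

/-- The zero set of `Re P` in the plane. -/
def reLevel (P : ℂ[X]) : Set ℂ := {z | (P.eval z).re = 0}

/-- The zero set of `Im P` in the plane. -/
def imLevel (P : ℂ[X]) : Set ℂ := {z | (P.eval z).im = 0}

/-- The harmonic web of `P`: the superposition of the two level sets. -/
def harmonicWeb (P : ℂ[X]) : Set ℂ := reLevel P ∪ imLevel P

/-- The radial homeomorphism `z ↦ z / √(1 + |z|²)` of the plane onto the open unit disc,
with values regarded as complex numbers. -/
noncomputable def toDisc (z : ℂ) : ℂ := (Homeomorph.unitBall z : ℂ)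

/-- `A` is a simple arc (a homeomorphic image of `[0, 1]`) with end points `a` and `b`. -/
def IsArcBetween (a b : ℂ) (A : Set ℂ) : Prop :=
  ∃ γ : unitInterval → ℂ, Continuous γ ∧ Function.Injective γ ∧
    γ 0 = a ∧ γ 1 = b ∧ Set.range γ = A

/-- A chord diagram: a finite graph without isolated vertices, drawn in the closed unit disc.
Vertices are points of the disc, edges are simple arcs which meet each other and the vertex set
only at their end points, the leaves (vertices of valency one) lie on the boundary circle and all
the rest of the graph lies in the open disc. It is not assumed that the graph has no cycles. -/
structure ChordDiagram where
  /-- the vertices of the graph, as points of the plane -/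
  nodes : Finset ℂ
  /-- the incidence relation of the graph -/
  graph : SimpleGraph nodes
  /-- the arc that draws an edge (meaningful only for the edges of `graph`) -/
  arc : Sym2 nodes → Set ℂ
  isArc : ∀ u v : nodes, graph.Adj u v → IsArcBetween u v (arc s(u, v))
  arc_inter_nodes : ∀ u v : nodes, graph.Adj u v → arc s(u, v) ∩ (nodes : Set ℂ) = {(u : ℂ), (v : ℂ)}
  arc_inter_arc : ∀ e ∈ graph.edgeSet, ∀ f ∈ graph.edgeSet, e ≠ f →
    arc e ∩ arc f ⊆ (nodes : Set ℂ)
  not_isolated : ∀ v : nodes, ∃ u : nodes, graph.Adj v u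
  leaf_mem_circle : ∀ v : nodes, (graph.neighborSet v).ncard = 1 → ‖(v : ℂ)‖ = 1
  inner_mem_disc : ∀ v : nodes, (graph.neighborSet v).ncard ≠ 1 → ‖(v : ℂ)‖ < 1
  arc_mem_disc : ∀ e ∈ graph.edgeSet, ∀ z ∈ arc e, z ∉ nodes → ‖z‖ < 1

namespace ChordDiagram

/-- The valency of a vertex: the number of edges incident to it. -/
noncomputable def valency (D : ChordDiagram) (v : D.nodes) : ℕ := (D.graph.neighborSet v).ncard

/-- Leaves are the vertices of valency one. -/
def IsLeaf (D : ChordDiagram) (v : D.nodes) : Prop := D.valency v = 1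

/-- Inner nodes are the vertices that are not leaves. -/
def IsInner (D : ChordDiagram) (v : D.nodes) : Prop := ¬ D.IsLeaf v

/-- The subset of the closed disc covered by the diagram. -/
def support (D : ChordDiagram) : Set ℂ := (D.nodes : Set ℂ) ∪ ⋃ e ∈ D.graph.edgeSet, D.arc e

/-- The diagram `D` represents the harmonic web of `P`: the radial homeomorphism of the plane onto
the open disc carries the web onto the part of `D` in the open disc (that is, `D` minus its leaves),
and each edge of `D` comes from one of the two level sets `Re P = 0` and `Im P = 0`. -/
def Represents (D : ChordDiagram) (P : ℂ[X]) : Prop :=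
  toDisc '' harmonicWeb P = D.support ∩ Metric.ball 0 1 ∧
  ∀ e ∈ D.graph.edgeSet,
    D.arc e ∩ Metric.ball 0 1 ⊆ toDisc '' reLevel P ∨
    D.arc e ∩ Metric.ball 0 1 ⊆ toDisc '' imLevel P

end ChordDiagram

open Filter Topology Set

/-! The web is the preimage under `P` of four half-axes. Measure the modulus of a value `w` by `s =
|w| / (1 + |w|)`, so that infinity is `s = 1`, and cut `[0, 1]` at the parameters of the critical
values. Over each open piece of each half-axis `P` is a covering, and the preimage consists of `n`
disjoint curves of roots. They converge at both ends, and the factorization `P - w = c ∏ (X - γ i)`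
passes to the limit, so a point is an end of as many of the curves over an adjacent piece as its
local degree (`exists_disc_curves`). At infinity, rescaled curves tend to the `n` simple roots of a
pure equation `z ^ n = ρ / c`, so each boundary point receives one arc
(`exists_tendsto_toDisc_root_curves`). Counting adjacent pieces gives valency `4m` at a zero, `2m`
at the other inner nodes and `1` on the circle, with `n` leaves for each half-axis.

Acyclicity comes from polynomial potentials (`exists_potential`). Fix an arc and a point `γ₀` inside
it with value `w₀`. Take primitives of `P' * L * Q(P)`, where `L = (P - w₀) / (X - γ₀)` vanishes at
the other points over `w₀` and `Q` concentrates at `w₀` along the axes. Since `P'(γ) γ' = w'`, the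
increment along an arc is an integral of `L(γ) Q(w) dw`. After normalization the increments tend to
a nonzero limit on the chosen arc and to `0` on every other. Increments along a closed path sum to
zero, so every edge is a bridge; for the same reason no two arcs share both ends. -/

theorem exists_tendsto_of_finite_fiber {α : Type*} {l : Filter α} [l.NeBot] {u : α → ℂ}
    {f : ℂ → ℂ} {K : Set ℂ} {y : ℂ} (hK : IsCompact K) (huK : ∀ᶠ t in l, u t ∈ K)
    (hconn : ∀ s ∈ l, ∃ t ∈ l, t ⊆ s ∧ IsPreconnected (u '' t))
    (hf : Continuous f) (hy : Tendsto (fun t => f (u t)) l (𝓝 y))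
    (hfin : {z | f z = y}.Finite) : ∃ z, Tendsto u l (𝓝 z) := by
  obtain ⟨z, -, hz⟩ := hK.exists_mapClusterPt (le_principal_iff.2 huK)
  refine ⟨z, Metric.tendsto_nhds.2 fun ε₀ hε₀ => ?_⟩
  -- Finitely many spheres about the cluster point `z` meet the fibre, so some small one misses it.
  -- Its image is compact and avoids `y`, hence eventually the curve cannot cross it, and a
  -- connected tail that enters the ball stays inside.
  have hinf : (Ioo 0 ε₀ \ (fun x => dist x z) '' {z | f z = y}).Nonempty :=
    ((Ioo_infinite hε₀).sdiff (hfin.image _)).nonempty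
  obtain ⟨ε, ⟨hε, hεε₀⟩, hεn⟩ := hinf
  have hcl : IsClosed (f '' Metric.sphere z ε) := ((isCompact_sphere z ε).image hf).isClosed
  have hyn : y ∉ f '' Metric.sphere z ε := by
    rintro ⟨x, hx, rfl⟩
    exact hεn ⟨x, rfl, hx⟩
  have hev : ∀ᶠ t in l, f (u t) ∉ f '' Metric.sphere z ε :=
    hy.eventually (hcl.isOpen_compl.mem_nhds hyn)
  obtain ⟨s, hs, hsub, hcon⟩ := hconn _ hev
  have hcov : u '' s ⊆ Metric.ball z ε ∪ (Metric.closedBall z ε)ᶜ := by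
    rintro _ ⟨t, ht, rfl⟩
    by_contra! h
    simp only [mem_union, Metric.mem_ball, mem_compl_iff, Metric.mem_closedBall, not_or, not_lt,
      not_not] at h
    exact hsub ht ⟨u t, le_antisymm h.2 h.1, rfl⟩
  have hne : (u '' s ∩ Metric.ball z ε).Nonempty := by
    have := (mapClusterPt_iff_frequently.1 hz _ (Metric.ball_mem_nhds z hε)).and_eventually hs
    obtain ⟨t, ht, hts⟩ := this.exists
    exact ⟨u t, ⟨t, hts, rfl⟩, ht⟩
  have hsb : u '' s ⊆ Metric.ball z ε := by
    refine hcon.subset_left_of_subset_union Metric.isOpen_ball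
      Metric.isClosed_closedBall.isOpen_compl ?_ hcov hne
    exact disjoint_compl_right.mono_left Metric.ball_subset_closedBall
  filter_upwards [hs] with t ht
  exact (hsb ⟨t, ht, rfl⟩ : dist (u t) z < ε).trans hεε₀

theorem exists_mem_nhdsGT_isPreconnected_image {u : ℝ → ℂ} {a b : ℝ} (hab : a < b)
    (hu : ContinuousOn u (Ioo a b)) :
    ∀ s ∈ 𝓝[>] a, ∃ t ∈ 𝓝[>] a, t ⊆ s ∧ IsPreconnected (u '' t) := by
  intro s hs
  obtain ⟨c, hc, hcs⟩ := mem_nhdsGT_iff_exists_Ioo_subset.1 hs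
  exact ⟨Ioo a (min c b), Ioo_mem_nhdsGT (lt_min hc hab),
    (Ioo_subset_Ioo_right (min_le_left _ _)).trans hcs,
    isPreconnected_Ioo.image _ (hu.mono (Ioo_subset_Ioo_right (min_le_right _ _)))⟩

theorem exists_mem_nhdsLT_isPreconnected_image {u : ℝ → ℂ} {a b : ℝ} (hab : a < b)
    (hu : ContinuousOn u (Ioo a b)) :
    ∀ s ∈ 𝓝[<] b, ∃ t ∈ 𝓝[<] b, t ⊆ s ∧ IsPreconnected (u '' t) := by
  intro s hs
  obtain ⟨c, hc, hcs⟩ := mem_nhdsLT_iff_exists_Ioo_subset.1 hs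
  exact ⟨Ioo (max c a) b, Ioo_mem_nhdsLT (max_lt hc hab),
    (Ioo_subset_Ioo_left (le_max_left _ _)).trans hcs,
    isPreconnected_Ioo.image _ (hu.mono (Ioo_subset_Ioo_left (le_max_right _ _)))⟩

/-! ### Curves of roots over segments of regular values -/

namespace Polynomial

theorem eval_eq_iff_mem_roots {P : ℂ[X]} (hP : 0 < P.natDegree) {w z : ℂ} :
    z ∈ (P - C w).roots ↔ P.eval z = w := by
  have : P - C w ≠ 0 := fun h => by
    rw [sub_eq_zero.1 h, natDegree_C] at hP; exact lt_irrefl _ hP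
  rw [mem_roots this, IsRoot, eval_sub, eval_C, sub_eq_zero]

theorem card_roots_sub_C_eq (P : ℂ[X]) (w : ℂ) :
    Multiset.card (P - C w).roots = P.natDegree := by
  rw [IsAlgClosed.card_roots_eq_natDegree, natDegree_sub_C]

theorem nodup_roots_sub_C {P : ℂ[X]} {w : ℂ}
    (h : ∀ z, P.derivative.eval z = 0 → P.eval z ≠ w) : (P - C w).roots.Nodup := by
  refine nodup_roots ?_
  rw [separable_def]
  refine isCoprime_of_dvd _ _ ?_ ?_
  · rintro ⟨h1, h2⟩
    exact h 0 (by simpa using congrArg (eval 0) h2)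
      (by simpa [sub_eq_zero] using congrArg (eval 0) h1)
  · intro q hq hq0 h1 h2
    have hdeg : q.degree ≠ 0 := fun hd => hq (isUnit_iff_degree_eq_zero.2 hd)
    obtain ⟨z, hz⟩ := IsAlgClosed.exists_root q hdeg
    refine h z ?_ ?_
    · simpa using hz.dvd h2
    · simpa [sub_eq_zero] using hz.dvd h1

theorem sub_C_eq_prod_of_injective {P : ℂ[X]} {n : ℕ} (hP : P.natDegree = n) (hn : 0 < n)
    {w : ℂ} {v : Fin n → ℂ} (hv : ∀ i, P.eval (v i) = w) (hinj : Function.Injective v) :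
    P - C w = C P.leadingCoeff * ∏ i, (X - C (v i)) := by
  have hroots : (P - C w).roots = Finset.univ.val.map v := by
    symm
    refine Multiset.eq_of_le_of_card_le ?_ ?_
    · refine (Multiset.le_iff_subset (Finset.univ.nodup.map hinj)).2 fun z hz => ?_
      obtain ⟨i, -, rfl⟩ := Multiset.mem_map.1 hz
      exact (eval_eq_iff_mem_roots (hP ▸ hn)).2 (hv i)
    · rw [card_roots_sub_C_eq, hP]; simp
  have := C_leadingCoeff_mul_prod_multiset_X_sub_C (p := P - C w)
    (IsAlgClosed.card_roots_eq_natDegree)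
  rw [hroots, Multiset.map_map] at this
  rw [← this, leadingCoeff_sub_of_degree_lt]
  · rfl
  · exact degree_C_le.trans_lt (natDegree_pos_iff_degree_pos.1 (hP ▸ hn))

theorem card_eq_rootMultiplicity_of_eq_prod {Q : ℂ[X]} {n : ℕ} {c : ℂ} (hc : c ≠ 0)
    {v : Fin n → ℂ} (h : Q = C c * ∏ i, (X - C (v i))) (z : ℂ) :
    (Finset.univ.filter fun i => v i = z).card = Q.rootMultiplicity z := by
  have : Q.roots = Finset.univ.val.map v := by
    rw [h, roots_C_mul _ hc, roots_prod]
    · simp [Multiset.bind_singleton]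
    · exact Finset.prod_ne_zero_iff.2 fun i _ => X_sub_C_ne_zero _
  rw [← count_roots, this, Multiset.count_map]
  simp only [eq_comm]
  rfl

/-- Over an open interval of regular values, the roots of `P - w t` form continuous curves. -/
theorem exists_root_curves {P : ℂ[X]} {n : ℕ} (hP : P.natDegree = n) (hn : 0 < n) {a b : ℝ}
    (hab : a < b) {w : ℝ → ℂ} (hw : ContinuousOn w (Ioo a b))
    (hreg : ∀ t ∈ Ioo a b, ∀ z, P.derivative.eval z = 0 → P.eval z ≠ w t) :
    ∃ γ : Fin n → ℝ → ℂ, (∀ i, ContinuousOn (γ i) (Ioo a b)) ∧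
      (∀ i, ∀ t ∈ Ioo a b, P.eval (γ i t) = w t) ∧
      ∀ t ∈ Ioo a b, Function.Injective fun i => γ i t := by
  obtain ⟨t₀, ht₀⟩ := nonempty_Ioo.2 hab
  have hcard : (P - C (w t₀)).roots.toFinset.card = n := by
    rw [Multiset.toFinset_card_of_nodup (nodup_roots_sub_C (hreg t₀ ht₀)), card_roots_sub_C_eq, hP]
  let ev := (Finset.equivFinOfCardEq hcard).symm
  have : ContractibleSpace (Ioo a b) := (convex_Ioo a b).contractibleSpace ⟨t₀, ht₀⟩
  have : LocallyPathConnectedSpace (Ioo a b) := isOpen_Ioo.locallyPathConnectedSpace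
  let f : C(Ioo a b, ℂ) := ⟨fun t => w t, continuousOn_iff_continuous_domRestrict.1 hw⟩
  -- Away from critical values `P` is a covering, and the interval is simply connected, so lifts
  -- exist and are fixed by one value.
  have key : ∀ (t : Ioo a b) (z : ℂ), P.eval z = f t →
      ∃! F : C(Ioo a b, ℂ), F t = z ∧ P.eval ∘ F = f := by
    intro t z hz
    refine P.isCoveringMapOn_eval.existsUnique_continuousMap_lifts f (a₀ := t) hz ?_
    rintro s ⟨z, hz, hz'⟩
    exact hreg s s.2 z hz hz'
  have hev : ∀ i, P.eval (ev i : ℂ) = f ⟨t₀, ht₀⟩ := fun i =>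
    (eval_eq_iff_mem_roots (hP ▸ hn)).1 (Multiset.mem_toFinset.1 (ev i).2)
  choose F hF using fun i => (key ⟨t₀, ht₀⟩ (ev i) (hev i)).exists
  have hPF : ∀ i s, P.eval (F i s) = f s := fun i s => congrFun (hF i).2 s
  refine ⟨fun i t => if h : t ∈ Ioo a b then F i ⟨t, h⟩ else 0, fun i => ?_, fun i t ht => ?_,
    fun t ht i j hij => ?_⟩
  · rw [continuousOn_iff_continuous_domRestrict]
    refine (F i).continuous.congr fun t => ?_
    have ht := t.2
    simp only [domRestrict_apply, ht, dite_true, Subtype.coe_eta]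
  · exact (congrArg (fun z => P.eval z) (dif_pos ht)).trans (hPF i ⟨t, ht⟩)
  · have hij' : F i ⟨t, ht⟩ = F j ⟨t, ht⟩ := by simpa [ht] using hij
    have hFij : F i = F j :=
      (key ⟨t, ht⟩ _ (hPF i ⟨t, ht⟩)).unique ⟨rfl, (hF i).2⟩ ⟨hij'.symm, (hF j).2⟩
    refine ev.injective (Subtype.ext ?_)
    rw [← (hF i).1, ← (hF j).1, hFij]

/-- Curves of roots converge, with multiplicities, when the value converges. -/
theorem exists_tendsto_root_curves {P : ℂ[X]} {n : ℕ} (hP : P.natDegree = n) (hn : 0 < n)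
    {l : Filter ℝ} [l.NeBot] {w : ℝ → ℂ} {w₀ : ℂ} (hw : Tendsto w l (𝓝 w₀))
    {γ : Fin n → ℝ → ℂ}
    (hconn : ∀ i, ∀ s ∈ l, ∃ t ∈ l, t ⊆ s ∧ IsPreconnected (γ i '' t))
    (hγ : ∀ᶠ t in l, P - C (w t) = C P.leadingCoeff * ∏ i, (X - C (γ i t))) :
    ∃ v : Fin n → ℂ, (∀ i, Tendsto (γ i) l (𝓝 (v i))) ∧
      P - C w₀ = C P.leadingCoeff * ∏ i, (X - C (v i)) := by
  have hdeg : 0 < P.degree := natDegree_pos_iff_degree_pos.1 (hP ▸ hn)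
  have hroot : ∀ i, ∀ᶠ t in l, P.eval (γ i t) = w t := by
    intro i
    filter_upwards [hγ] with t ht
    have := congrArg (eval (γ i t)) ht
    rw [eval_sub, eval_C, eval_mul, eval_prod,
      Finset.prod_eq_zero (Finset.mem_univ i) (by simp), mul_zero] at this
    exact sub_eq_zero.1 this
  have hlim : ∀ i, ∃ v, Tendsto (γ i) l (𝓝 v) := by
    intro i
    have ht : Tendsto (fun t => P.eval (γ i t)) l (𝓝 w₀) :=
      hw.congr' ((hroot i).mono fun t ht => ht.symm)
    refine exists_tendsto_of_finite_fiber (f := fun z => P.eval z)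
      ((P.isProperMap_eval hdeg).isCompact_preimage (isCompact_closedBall w₀ 1)) ?_ (hconn i)
      P.continuous ht ?_
    · exact ht.eventually (Metric.closedBall_mem_nhds _ one_pos)
    · refine (P - C w₀).roots.toFinset.finite_toSet.subset fun z hz => ?_
      simpa [← eval_eq_iff_mem_roots (hP ▸ hn)] using hz
  choose v hv using hlim
  -- Passing to the limit in the factorization, evaluated at each `x`, keeps track of multiplicities
  -- when roots collide.
  refine ⟨v, hv, Polynomial.funext fun x => ?_⟩
  refine tendsto_nhds_unique (f := fun t => (P - C (w t)).eval x) (l := l) ?_ ?_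
  · simp only [eval_sub, eval_C]
    exact tendsto_const_nhds.sub hw
  · have : Tendsto (fun t => P.leadingCoeff * ∏ i, (x - γ i t)) l
        (𝓝 (P.leadingCoeff * ∏ i, (x - v i))) :=
      tendsto_const_nhds.mul (tendsto_finsetProd _ fun i _ => tendsto_const_nhds.sub (hv i))
    simp only [eval_mul, eval_prod, eval_sub, eval_C, eval_X]
    refine this.congr' ?_
    filter_upwards [hγ] with t ht
    have := congrArg (eval x) ht
    simp only [eval_mul, eval_prod, eval_sub, eval_C, eval_X] at this
    exact this.symm

end Polynomial

/-! ### Extension of the polynomial to the closed disc -/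

theorem toDisc_eq (z : ℂ) : toDisc z = (√(1 + ‖z‖ ^ 2))⁻¹ • z := rfl

/-- The inverse of `toDisc` on the open unit disc. -/
noncomputable def fromDisc (v : ℂ) : ℂ := (√(1 - ‖v‖ ^ 2))⁻¹ • v

theorem norm_toDisc_lt_one (z : ℂ) : ‖toDisc z‖ < 1 :=
  mem_ball_zero_iff.1 (Homeomorph.unitBall z).2

theorem fromDisc_toDisc (z : ℂ) : fromDisc (toDisc z) = z :=
  (OpenPartialHomeomorph.univUnitBall (E := ℂ)).left_inv (mem_univ z)

theorem toDisc_fromDisc {v : ℂ} (hv : ‖v‖ < 1) : toDisc (fromDisc v) = v :=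
  (OpenPartialHomeomorph.univUnitBall (E := ℂ)).right_inv (by
    simpa [OpenPartialHomeomorph.univUnitBall] using hv)

theorem continuous_toDisc : Continuous toDisc :=
  continuous_subtype_val.comp Homeomorph.unitBall.continuous

theorem continuousOn_fromDisc : ContinuousOn fromDisc (Metric.ball 0 1) :=
  (OpenPartialHomeomorph.univUnitBall (E := ℂ)).continuousOn_invFun

theorem toDisc_injective : Function.Injective toDisc :=
  Function.LeftInverse.injective fromDisc_toDisc

/-- The self-map of the closed unit disc induced by a polynomial: on the open disc it is
conjugate to `P`, followed by the radial contraction `w ↦ w / (1 + |w|)`. -/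
noncomputable def discMap (P : ℂ[X]) (v : ℂ) : ℂ :=
  if ‖v‖ < 1 then P.eval (fromDisc v) / ((1 + ‖P.eval (fromDisc v)‖ : ℝ) : ℂ)
  -- On the circle this is the limiting direction of `P` at infinity. Outside it the norm is `‖v‖ ^
  -- n`, so for `P ≠ 0` values of norm below `1` come only from the open disc.
  else P.leadingCoeff / (‖P.leadingCoeff‖ : ℂ) * v ^ P.natDegree

/-- The local degree of `discMap P`. -/
noncomputable def discMult (P : ℂ[X]) (v : ℂ) : ℕ :=
  if ‖v‖ < 1 then (P - C (P.eval (fromDisc v))).rootMultiplicity (fromDisc v) else 1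

/-- `t ↦ t / (1 - t)` inverts the contraction `r ↦ r / (1 + r)`, so the parameter `t` is the norm of
`discMap`. -/
theorem discMap_toDisc {P : ℂ[X]} {z ρ : ℂ} (hρ : ‖ρ‖ = 1) {t : ℝ} (ht0 : 0 ≤ t) (ht1 : t < 1)
    (hz : P.eval z = ρ * (t / (1 - t) : ℝ)) : discMap P (toDisc z) = ρ * t := by
  have h1 : 0 < 1 - t := sub_pos.2 ht1
  rw [discMap, if_pos (norm_toDisc_lt_one z), fromDisc_toDisc, hz, norm_mul, hρ, one_mul,
    Complex.norm_of_nonneg (by positivity)]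
  have : 1 + t / (1 - t) = (1 - t)⁻¹ := by field_simp; ring
  rw [this]
  have h2 : (1 - t : ℂ) ≠ 0 := by exact_mod_cast h1.ne'
  push_cast
  field_simp

theorem norm_discMap_of_one_le_norm {P : ℂ[X]} (hP : P ≠ 0) {v : ℂ} (hv : 1 ≤ ‖v‖) :
    ‖discMap P v‖ = ‖v‖ ^ P.natDegree := by
  have : ‖P.leadingCoeff‖ ≠ 0 := norm_ne_zero_iff.2 (leadingCoeff_ne_zero.2 hP)
  rw [discMap, if_neg hv.not_gt, norm_mul, norm_div, norm_pow, Complex.norm_real, norm_norm,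
    div_self this, one_mul]

theorem norm_lt_one_of_discMap {P : ℂ[X]} (hP : P ≠ 0) {v ρ : ℂ} (hρ : ‖ρ‖ = 1) {t : ℝ}
    (ht0 : 0 ≤ t) (ht1 : t < 1) (h : discMap P v = ρ * t) : ‖v‖ < 1 := by
  by_contra! hv
  have := norm_discMap_of_one_le_norm hP hv
  rw [h, norm_mul, hρ, one_mul, Complex.norm_of_nonneg ht0] at this
  exact (ht1.trans_le (this ▸ one_le_pow₀ hv)).false

theorem eval_fromDisc_of_discMap {P : ℂ[X]} (hP : P ≠ 0) {v ρ : ℂ} (hρ : ‖ρ‖ = 1) {t : ℝ}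
    (ht0 : 0 ≤ t) (ht1 : t < 1) (h : discMap P v = ρ * t) :
    P.eval (fromDisc v) = ρ * (t / (1 - t) : ℝ) := by
  have hv := norm_lt_one_of_discMap hP hρ ht0 ht1 h
  rw [discMap, if_pos hv] at h
  set w := P.eval (fromDisc v)
  have hw : 0 < 1 + ‖w‖ := by positivity
  have hn := congrArg norm h
  rw [norm_div, Complex.norm_of_nonneg hw.le, norm_mul, hρ, one_mul, Complex.norm_of_nonneg ht0,
    div_eq_iff hw.ne'] at hn
  have h1 : 1 - t ≠ 0 := (sub_pos.2 ht1).ne'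
  have hw' : 1 + ‖w‖ = (1 - t)⁻¹ := by
    refine eq_inv_of_mul_eq_one_left ?_; linear_combination hn
  rw [hw', div_eq_iff (by exact_mod_cast inv_ne_zero h1)] at h
  rw [h]; push_cast; ring

theorem norm_lt_one_of_norm_discMap_lt {P : ℂ[X]} (hP : P ≠ 0) {v : ℂ}
    (h : ‖discMap P v‖ < 1) : ‖v‖ < 1 := by
  by_contra! hv
  have := norm_discMap_of_one_le_norm hP hv
  exact (h.trans_le (this ▸ one_le_pow₀ hv)).false

theorem norm_discMap_lt_one {P : ℂ[X]} {v : ℂ} (hv : ‖v‖ < 1) : ‖discMap P v‖ < 1 := by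
  have : 0 < 1 + ‖P.eval (fromDisc v)‖ := by positivity
  rw [discMap, if_pos hv, norm_div, Complex.norm_of_nonneg this.le, div_lt_one this]
  linarith

theorem norm_eq_one_of_norm_discMap {P : ℂ[X]} (hP : 0 < P.natDegree) {v : ℂ}
    (h : ‖discMap P v‖ = 1) : ‖v‖ = 1 := by
  rcases lt_or_ge ‖v‖ 1 with hv | hv
  · exact absurd h (norm_discMap_lt_one hv).ne
  · rw [norm_discMap_of_one_le_norm (by rintro rfl; simp at hP) hv] at h
    exact (pow_eq_one_iff_of_nonneg (norm_nonneg _) hP.ne').1 h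

theorem discMap_of_norm_eq_one {P : ℂ[X]} {v : ℂ} (hv : ‖v‖ = 1) :
    discMap P v = P.leadingCoeff / (‖P.leadingCoeff‖ : ℂ) * v ^ P.natDegree :=
  if_neg hv.ge.not_gt

theorem discMult_pos {P : ℂ[X]} (hP : 0 < P.natDegree) (v : ℂ) : 0 < discMult P v := by
  unfold discMult
  split_ifs
  · rw [rootMultiplicity_pos]
    · simp
    · intro h
      rw [sub_eq_zero.1 h, natDegree_C] at hP
      exact lt_irrefl _ hP
  · exact one_pos

/-! ### Behaviour of the root curves at infinity -/

namespace Polynomial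

theorem tendsto_eval_div_pow_cobounded (P : ℂ[X]) :
    Tendsto (fun z => P.eval z / z ^ P.natDegree) (Bornology.cobounded ℂ) (𝓝 P.leadingCoeff) := by
  have h : Tendsto (fun z : ℂ => P.reverse.eval z⁻¹) (Bornology.cobounded ℂ)
      (𝓝 (P.reverse.eval 0)) :=
    (P.reverse.continuous.tendsto 0).comp tendsto_inv₀_cobounded
  rw [← coeff_zero_eq_eval_zero, coeff_zero_reverse] at h
  refine h.congr' ?_
  filter_upwards [Bornology.eventually_ne_cobounded (0 : ℂ)] with z hz
  have := invertibleOfNonzero hz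
  have h2 := eval₂_reverse_mul_pow (RingHom.id ℂ) z P
  rw [eq_div_iff (pow_ne_zero _ hz), ← invOf_eq_inv]
  exact h2

theorem tendsto_cobounded_of_tendsto_norm_eval {α : Type*} {l : Filter α} (P : ℂ[X]) {u : α → ℂ}
    (h : Tendsto (fun t => ‖P.eval (u t)‖) l atTop) : Tendsto u l (Bornology.cobounded ℂ) := by
  rw [← tendsto_norm_atTop_iff_cobounded, tendsto_atTop]
  intro R
  obtain ⟨B, hB⟩ := (isCompact_closedBall (0 : ℂ) R).exists_bound_of_continuousOn
    P.continuous.continuousOn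
  filter_upwards [h.eventually_gt_atTop B] with t ht
  by_contra! hlt
  exact (ht.trans_le (hB _ (by simpa using hlt.le))).false

theorem rootMultiplicity_X_pow_sub_C {n : ℕ} (hn : 0 < n) {a z : ℂ} (ha : a ≠ 0)
    (hz : z ^ n = a) : (X ^ n - C a : ℂ[X]).rootMultiplicity z = 1 := by
  have h0 : (X ^ n - C a : ℂ[X]) ≠ 0 := X_pow_sub_C_ne_zero hn a
  have hz0 : z ≠ 0 := by rintro rfl; exact ha (by rw [← hz, zero_pow hn.ne'])
  refine le_antisymm (not_lt.1 fun h => ?_) ((rootMultiplicity_pos h0).2 (by simp [hz]))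
  have := ((one_lt_rootMultiplicity_iff_isRoot h0).1 h).2
  simp [derivative_X_pow, hn.ne', hz0] at this

end Polynomial

theorem tendsto_div_one_sub_atTop :
    Tendsto (fun t : ℝ => t / (1 - t)) (𝓝[<] 1) atTop := by
  have h1 : Tendsto (fun t : ℝ => (1 - t)⁻¹) (𝓝[<] 1) atTop := by
    refine tendsto_inv_nhdsGT_zero.comp (tendsto_nhdsWithin_iff.2 ⟨?_, ?_⟩)
    · have : Tendsto (fun t : ℝ => 1 - t) (𝓝 1) (𝓝 (1 - 1)) :=
        (continuous_const.sub continuous_id).tendsto 1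
      rw [sub_self] at this
      exact this.mono_left nhdsWithin_le_nhds
    · filter_upwards [self_mem_nhdsWithin] with t ht
      exact mem_Ioi.2 (sub_pos.2 ht)
  refine (tendsto_atTop_add_const_right _ (-1) h1).congr' ?_
  filter_upwards [self_mem_nhdsWithin] with t ht
  have : 1 - t ≠ 0 := (sub_pos.2 ht).ne'
  field_simp
  ring

theorem continuousOn_div_one_sub : ContinuousOn (fun t : ℝ => t / (1 - t)) (Iio 1) :=
  continuousOn_id.div (continuousOn_const.sub continuousOn_id) fun _ ht =>
    (sub_pos.2 (mem_Iio.1 ht)).ne'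

/-- Near infinity the root curves over a ray are asymptotic to distinct directions. -/
theorem exists_tendsto_toDisc_root_curves {P : ℂ[X]} {n : ℕ} (hP : P.natDegree = n) (hn : 0 < n)
    {a : ℝ} (ha0 : 0 ≤ a) (ha1 : a < 1) {ρ : ℂ} (hρ : ‖ρ‖ = 1) {γ : Fin n → ℝ → ℂ}
    (hcont : ∀ i, ContinuousOn (γ i) (Ioo a 1))
    (hγ : ∀ t ∈ Ioo a 1, P - C (ρ * (t / (1 - t) : ℝ)) =
      C P.leadingCoeff * ∏ i, (X - C (γ i t))) :
    ∃ ω : Fin n → ℂ, (∀ i, Tendsto (fun t => toDisc (γ i t)) (𝓝[<] 1) (𝓝 (ω i))) ∧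
      (∀ i, discMap P (ω i) = ρ) ∧ (∀ i, ‖ω i‖ = 1) ∧
      ∀ v, ‖v‖ = 1 → discMap P v = ρ → (Finset.univ.filter fun i => ω i = v).card = 1 := by
  set c := P.leadingCoeff with hc
  have hP0 : P ≠ 0 := by rintro rfl; simp at hP; omega
  have hc0 : c ≠ 0 := leadingCoeff_ne_zero.2 hP0
  have hcn : (0 : ℝ) < ‖c‖ := norm_pos_iff.2 hc0
  have hρ0 : ρ ≠ 0 := by rintro rfl; simp at hρ
  have hev : ∀ᶠ t in 𝓝[<] (1 : ℝ), t ∈ Ioo a 1 := Ioo_mem_nhdsLT ha1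
  have hrpos : ∀ t ∈ Ioo a 1, 0 < t / (1 - t) := fun t ht =>
    div_pos (ha0.trans_lt ht.1) (sub_pos.2 ht.2)
  -- the scaling factor
  let s : ℝ → ℝ := fun t => (t / (1 - t)) ^ (-(1 / n : ℝ))
  have hspos : ∀ t ∈ Ioo a 1, 0 < s t := fun t ht => Real.rpow_pos_of_pos (hrpos t ht) _
  have hsn : ∀ t ∈ Ioo a 1, s t ^ n * (t / (1 - t)) = 1 := by
    intro t ht
    have : s t ^ n = (t / (1 - t))⁻¹ := by
      rw [← Real.rpow_natCast, ← Real.rpow_mul (hrpos t ht).le, neg_mul, one_div,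
        inv_mul_cancel₀ (by exact_mod_cast hn.ne'), Real.rpow_neg_one]
    rw [this, inv_mul_cancel₀ (hrpos t ht).ne']
  have hscont : ContinuousOn s (Ioo a 1) :=
    (continuousOn_div_one_sub.mono fun t ht => ht.2).rpow_const fun t ht => Or.inl (hrpos t ht).ne'
  have hs0 : Tendsto s (𝓝[<] 1) (𝓝 0) :=
    (tendsto_rpow_neg_atTop (by positivity)).comp tendsto_div_one_sub_atTop
  have hroot : ∀ i, ∀ t ∈ Ioo a 1, P.eval (γ i t) = ρ * (t / (1 - t) : ℝ) := by
    intro i t ht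
    have := congrArg (eval (γ i t)) (hγ t ht)
    rw [eval_sub, eval_C, eval_mul, eval_prod,
      Finset.prod_eq_zero (Finset.mem_univ i) (by simp), mul_zero] at this
    exact sub_eq_zero.1 this
  have hcob : ∀ i, Tendsto (γ i) (𝓝[<] 1) (Bornology.cobounded ℂ) := by
    intro i
    refine P.tendsto_cobounded_of_tendsto_norm_eval (tendsto_div_one_sub_atTop.congr' ?_)
    filter_upwards [hev] with t ht
    rw [hroot i t ht, norm_mul, hρ, one_mul, Complex.norm_of_nonneg (hrpos t ht).le]
  -- Since `P z ~ c * z ^ n` at infinity and `s ^ n` is the reciprocal of the modulus of the value,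
  -- the rescaled roots satisfy the leading-order equation in the limit.
  have hpow : ∀ i, Tendsto (fun t => (s t • γ i t) ^ n) (𝓝[<] 1) (𝓝 (ρ / c)) := by
    intro i
    have h1 := (P.tendsto_eval_div_pow_cobounded.comp (hcob i)).inv₀ hc0
    have h2 := h1.const_mul ρ
    rw [← div_eq_mul_inv] at h2
    refine h2.congr' ?_
    filter_upwards [hev] with t ht
    have h3 : ((s t : ℂ) ^ n) * ((t / (1 - t) : ℝ) : ℂ) = 1 := by exact_mod_cast hsn t ht
    have h4 : ((t / (1 - t) : ℝ) : ℂ) ≠ 0 := by exact_mod_cast (hrpos t ht).ne'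
    simp only [Function.comp, hroot i t ht, hP, Complex.real_smul, mul_pow]
    rw [inv_div, mul_div_assoc', mul_div_mul_left _ _ hρ0, div_eq_iff h4]
    linear_combination (-(γ i t) ^ n) * h3
  have hlim : ∀ i, ∃ v, Tendsto (fun t => s t • γ i t) (𝓝[<] 1) (𝓝 v) := by
    intro i
    have hdeg : 0 < (X ^ n : ℂ[X]).degree := by
      rw [degree_X_pow]; exact_mod_cast hn
    refine exists_tendsto_of_finite_fiber (f := fun z => z ^ n)
      (((X ^ n : ℂ[X]).isProperMap_eval hdeg).isCompact_preimage (isCompact_closedBall (ρ / c) 1))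
      ?_ (exists_mem_nhdsLT_isPreconnected_image ha1 (hscont.smul (hcont i)))
      (continuous_pow n) (hpow i) ?_
    · filter_upwards [(hpow i).eventually (Metric.closedBall_mem_nhds _ one_pos)] with t ht
      simpa using ht
    · refine (nthRoots n (ρ / c)).toFinset.finite_toSet.subset fun z hz => ?_
      simpa [mem_nthRoots hn] using hz
  choose v hv using hlim
  have hvn : ∀ i, v i ^ n = ρ / c := fun i => tendsto_nhds_unique ((hv i).pow n) (hpow i)
  -- Evaluate the factorization at `x / s` and multiply by `s ^ n / c`: in the limit the leading
  -- term and the constant survive. This needs `x ≠ 0`, which still leaves infinitely many points.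
  have hprod : (X ^ n - C (ρ / c) : ℂ[X]) = C 1 * ∏ i, (X - C (v i)) := by
    refine eq_of_infinite_eval_eq _ _ (Set.Infinite.mono (s := {x | x ≠ 0}) ?_ ?_)
    swap
    · exact (Set.finite_singleton (0 : ℂ)).infinite_compl
    intro x hx
    rw [mem_ofPred_eq]
    refine tendsto_nhds_unique (f := fun t => ∏ i, (x - s t • γ i t)) (l := 𝓝[<] 1) ?_ ?_
    swap
    · simp only [eval_mul, eval_C, one_mul, eval_prod, eval_sub, eval_X]
      exact tendsto_finsetProd _ fun i _ => tendsto_const_nhds.sub (hv i)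
    · have hx' : Tendsto (fun t => (s t)⁻¹ • x) (𝓝[<] 1) (Bornology.cobounded ℂ) := by
        rw [← tendsto_norm_atTop_iff_cobounded]
        simp only [norm_smul]
        refine Tendsto.atTop_mul_const (norm_pos_iff.2 hx) ?_
        have : Tendsto s (𝓝[<] 1) (𝓝[>] 0) := tendsto_nhdsWithin_iff.2 ⟨hs0, hev.mono hspos⟩
        refine (tendsto_inv_nhdsGT_zero.comp this).congr' ?_
        filter_upwards [hev] with t ht
        rw [Real.norm_of_nonneg (inv_pos.2 (hspos t ht)).le]; rfl
      have h1 := ((P.tendsto_eval_div_pow_cobounded.comp hx').const_mul (x ^ n / c)).sub_const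
        (ρ / c)
      rw [← hc, div_mul_cancel₀ _ hc0] at h1
      simp only [eval_sub, eval_pow, eval_X, eval_C]
      refine h1.congr' ?_
      filter_upwards [hev] with t ht
      have hst : (s t : ℂ) ≠ 0 := by exact_mod_cast (hspos t ht).ne'
      have h3 : ((s t : ℂ) ^ n) * ((t / (1 - t) : ℝ) : ℂ) = 1 := by exact_mod_cast hsn t ht
      have h4 := congrArg (eval ((s t)⁻¹ • x)) (hγ t ht)
      simp only [eval_sub, eval_C, eval_mul, eval_prod, eval_X] at h4
      have h5 : ∏ i, (x - s t • γ i t) = (s t : ℂ) ^ n * ∏ i, ((s t)⁻¹ • x - γ i t) := by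
        have h0 : (s t : ℂ) ^ n = ∏ _i : Fin n, (s t : ℂ) := by simp
        rw [h0, ← Finset.prod_mul_distrib]
        refine Finset.prod_congr rfl fun i _ => ?_
        simp only [Complex.real_smul]; push_cast
        field_simp
      rw [h5]
      have h6 : ∏ i, ((s t)⁻¹ • x - γ i t) =
          (P.eval ((s t)⁻¹ • x) - ρ * (t / (1 - t) : ℝ)) / c := by
        rw [eq_div_iff hc0, h4]; ring
      rw [h6]
      simp only [Function.comp, hP]
      generalize P.eval ((s t)⁻¹ • x) = y
      have h7 : ((s t)⁻¹ • x) ^ n = ((s t : ℂ) ^ n)⁻¹ * x ^ n := by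
        rw [Complex.real_smul, mul_pow]; push_cast; rw [inv_pow]
      rw [h7]
      have hxn := pow_ne_zero n hx
      have hsn' := pow_ne_zero n hst
      field_simp
      linear_combination ρ * h3
  -- the common modulus of the limits
  have hk : ∀ i, ‖v i‖ = ‖c‖⁻¹ ^ (1 / n : ℝ) := by
    intro i
    have h1 : ‖v i‖ ^ n = ‖c‖⁻¹ := by
      rw [← norm_pow, hvn, norm_div, hρ, one_div]
    rw [← h1, ← Real.rpow_natCast, ← Real.rpow_mul (norm_nonneg _), mul_one_div_cancel
      (by exact_mod_cast hn.ne'), Real.rpow_one]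
  set k : ℝ := ‖c‖⁻¹ ^ (1 / n : ℝ) with hkdef
  have hkpos : 0 < k := Real.rpow_pos_of_pos (inv_pos.2 hcn) _
  have hkn : k ^ n = ‖c‖⁻¹ := by
    rw [hkdef, ← Real.rpow_natCast, ← Real.rpow_mul (inv_pos.2 hcn).le, one_div_mul_cancel
      (by exact_mod_cast hn.ne'), Real.rpow_one]
  have hkn' : (k : ℂ) ^ n = (‖c‖ : ℂ)⁻¹ := by exact_mod_cast hkn
  have hkC : (k : ℂ) ≠ 0 := by exact_mod_cast hkpos.ne'
  have hcnC : (‖c‖ : ℂ) ≠ 0 := by exact_mod_cast hcn.ne'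
  have hnorm : ∀ i, ‖k⁻¹ • v i‖ = 1 := by
    intro i
    rw [norm_smul, hk, Real.norm_of_nonneg (inv_pos.2 hkpos).le, inv_mul_cancel₀ hkpos.ne']
  refine ⟨fun i => k⁻¹ • v i, fun i => ?_, fun i => ?_, hnorm, fun x hx1 hx => ?_⟩
  -- `toDisc` is written in terms of the rescaled curve: `sγ / √(s² + |sγ|²)` tends to `v / |v|`
  -- because `s` tends to `0`.
  · have h1 : Tendsto (fun t => (√(s t ^ 2 + ‖s t • γ i t‖ ^ 2))⁻¹ • (s t • γ i t)) (𝓝[<] 1)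
        (𝓝 ((√(0 ^ 2 + ‖v i‖ ^ 2))⁻¹ • v i)) := by
      refine Tendsto.smul (Tendsto.inv₀ ?_ ?_) (hv i)
      · exact (Real.continuous_sqrt.tendsto _).comp ((hs0.pow 2).add ((hv i).norm.pow 2))
      · rw [hk]; positivity
    have h2 : √(0 ^ 2 + ‖v i‖ ^ 2) = k := by
      rw [hk, zero_pow two_ne_zero, zero_add, Real.sqrt_sq hkpos.le]
    rw [h2] at h1
    refine h1.congr' ?_
    filter_upwards [hev] with t ht
    have hst := hspos t ht
    rw [toDisc_eq, smul_smul]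
    congr 1
    rw [norm_smul, Real.norm_of_nonneg hst.le]
    have : s t ^ 2 + (s t * ‖γ i t‖) ^ 2 = s t ^ 2 * (1 + ‖γ i t‖ ^ 2) := by ring
    rw [this, Real.sqrt_mul (sq_nonneg _), Real.sqrt_sq hst.le]
    have : √(1 + ‖γ i t‖ ^ 2) ≠ 0 := by positivity
    field_simp
  · rw [discMap_of_norm_eq_one (hnorm i), hP, ← hc, Complex.real_smul, mul_pow, hvn]
    push_cast
    rw [inv_pow, hkn']
    field_simp
  · rw [discMap_of_norm_eq_one hx1, hP, ← hc] at hx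
    have h1 : (k * x) ^ n = ρ / c := by
      rw [mul_pow, hkn', ← hx]
      field_simp
    -- The roots of the limiting equation are simple, so each boundary direction is taken exactly
    -- once.
    rw [← rootMultiplicity_X_pow_sub_C hn (div_ne_zero hρ0 hc0) h1,
      ← card_eq_rootMultiplicity_of_eq_prod one_ne_zero hprod]
    congr 1
    ext i
    simp only [Finset.mem_filter, Finset.mem_univ, true_and, Complex.real_smul]
    push_cast
    rw [inv_mul_eq_iff_eq_mul₀ hkC]

/-! ### Closed arcs in the disc and their end multiplicities -/

theorem discMap_toDisc_of_eq_prod {P : ℂ[X]} {n : ℕ} (hP : P.natDegree = n) (hn : 0 < n)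
    {ρ : ℂ} (hρ : ‖ρ‖ = 1) {t : ℝ} (ht0 : 0 ≤ t) (ht1 : t < 1) {v : Fin n → ℂ}
    (hv : P - C (ρ * (t / (1 - t) : ℝ)) = C P.leadingCoeff * ∏ i, (X - C (v i))) :
    (∀ i, discMap P (toDisc (v i)) = ρ * t) ∧
      ∀ x, discMap P x = ρ * t →
        (Finset.univ.filter fun i => toDisc (v i) = x).card = discMult P x := by
  have hP0 : P ≠ 0 := by rintro rfl; simp at hP; omega
  refine ⟨fun i => discMap_toDisc hρ ht0 ht1 ?_, fun x hx => ?_⟩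
  · have := congrArg (eval (v i)) hv
    rw [eval_sub, eval_C, eval_mul, eval_prod,
      Finset.prod_eq_zero (Finset.mem_univ i) (by simp), mul_zero] at this
    exact sub_eq_zero.1 this
  · have hx1 := norm_lt_one_of_discMap hP0 hρ ht0 ht1 hx
    have hx2 := eval_fromDisc_of_discMap hP0 hρ ht0 ht1 hx
    rw [discMult, if_pos hx1, hx2,
      ← card_eq_rootMultiplicity_of_eq_prod (leadingCoeff_ne_zero.2 hP0) hv]
    congr 1
    ext i
    simp only [Finset.mem_filter, Finset.mem_univ, true_and]
    constructor
    · rintro rfl; rw [fromDisc_toDisc]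
    · intro h; rw [h, toDisc_fromDisc hx1]

/-- Over a segment of a ray with regular interior, the fibres of `discMap P` are formed by
`n` arcs, disjoint over the interior, and the arcs ending at a point are counted by `discMult`. -/
theorem exists_disc_curves {P : ℂ[X]} {n : ℕ} (hP : P.natDegree = n) (hn : 0 < n) {a b : ℝ}
    (ha : 0 ≤ a) (hab : a < b) (hb : b ≤ 1) {ρ : ℂ} (hρ : ‖ρ‖ = 1)
    (hreg : ∀ t ∈ Ioo a b, ∀ z, P.derivative.eval z = 0 → P.eval z ≠ ρ * (t / (1 - t) : ℝ)) :
    ∃ δ : Fin n → ℝ → ℂ, (∀ i, ContinuousOn (δ i) (Icc a b)) ∧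
      (∀ i, ∀ t ∈ Icc a b, discMap P (δ i t) = ρ * t) ∧
      (∀ t ∈ Ioo a b, Function.Injective fun i => δ i t) ∧
      ∀ t ∈ Icc a b, ∀ x, discMap P x = ρ * t →
        (Finset.univ.filter fun i => δ i t = x).card = discMult P x := by
  have hP0 : 0 < P.natDegree := hP ▸ hn
  have hwc : ContinuousOn (fun t : ℝ => ρ * ((t / (1 - t) : ℝ) : ℂ)) (Iio 1) :=
    continuousOn_const.mul (Complex.continuous_ofReal.comp_continuousOn continuousOn_div_one_sub)
  obtain ⟨γ, hcont, hroot, hinj⟩ := exists_root_curves hP hn hab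
    (hwc.mono fun t ht => ht.2.trans_le hb) hreg
  have hprod : ∀ t ∈ Ioo a b, P - C (ρ * (t / (1 - t) : ℝ)) =
      C P.leadingCoeff * ∏ i, (X - C (γ i t)) := fun t ht =>
    sub_C_eq_prod_of_injective hP hn (fun i => hroot i t ht) (hinj t ht)
  -- One argument for every end over a finite value; only the end `b = 1` requires the asymptotics
  -- at infinity.
  have hfin : ∀ (τ : ℝ) (l : Filter ℝ) [l.NeBot], l ≤ 𝓝 τ → 0 ≤ τ → τ < 1 → Ioo a b ∈ l →
      (∀ i, ∀ s ∈ l, ∃ t ∈ l, t ⊆ s ∧ IsPreconnected (γ i '' t)) →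
      ∃ ω : Fin n → ℂ, (∀ i, Tendsto (fun t => toDisc (γ i t)) l (𝓝 (ω i))) ∧
        (∀ i, discMap P (ω i) = ρ * τ) ∧ ∀ x, discMap P x = ρ * τ →
        (Finset.univ.filter fun i => ω i = x).card = discMult P x := by
    intro τ l _ hl hτ0 hτ1 hmem hconn
    obtain ⟨v, hv, hvp⟩ := exists_tendsto_root_curves hP hn
      (((hwc.continuousAt (Iio_mem_nhds hτ1)).tendsto).mono_left hl) hconn
      (mem_of_superset hmem hprod)
    obtain ⟨h1, h2⟩ := discMap_toDisc_of_eq_prod hP hn hρ hτ0 hτ1 hvp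
    exact ⟨fun i => toDisc (v i), fun i => (continuous_toDisc.tendsto _).comp (hv i), h1, h2⟩
  obtain ⟨α, hα1, hα2, hα3⟩ := hfin a (𝓝[>] a) nhdsWithin_le_nhds ha (hab.trans_le hb)
    (Ioo_mem_nhdsGT hab) fun i => exists_mem_nhdsGT_isPreconnected_image hab (hcont i)
  obtain ⟨β, hβ1, hβ2, hβ3⟩ : ∃ ω : Fin n → ℂ,
      (∀ i, Tendsto (fun t => toDisc (γ i t)) (𝓝[<] b) (𝓝 (ω i))) ∧
        (∀ i, discMap P (ω i) = ρ * b) ∧ ∀ x, discMap P x = ρ * b →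
        (Finset.univ.filter fun i => ω i = x).card = discMult P x := by
    rcases hb.lt_or_eq with hb | rfl
    · exact hfin b (𝓝[<] b) nhdsWithin_le_nhds (ha.trans hab.le) hb
        (Ioo_mem_nhdsLT hab) fun i => exists_mem_nhdsLT_isPreconnected_image hab (hcont i)
    · obtain ⟨ω, h1, h2, h3, h4⟩ := exists_tendsto_toDisc_root_curves hP hn ha hab hρ hcont hprod
      refine ⟨ω, h1, by simpa using h2, fun x hx => ?_⟩
      rw [Complex.ofReal_one, mul_one] at hx
      have hx1 : ‖x‖ = 1 := norm_eq_one_of_norm_discMap hP0 (by rw [hx, hρ])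
      rw [h4 x hx1 hx, discMult, if_neg hx1.ge.not_gt]
  have hE : ∀ i, ContinuousOn (fun t => toDisc (γ i t)) (Ioo a b) := fun i =>
    continuous_toDisc.comp_continuousOn (hcont i)
  have hδ : ∀ i, ∀ t ∈ Ioo a b,
      extendFrom (Ioo a b) (fun t => toDisc (γ i t)) t = toDisc (γ i t) := fun i t ht =>
    extendFrom_extends (hE i) t ht
  have hδa : ∀ i, extendFrom (Ioo a b) (fun t => toDisc (γ i t)) a = α i := fun i =>
    eq_lim_at_left_extendFrom_Ioo hab (hα1 i)
  have hδb : ∀ i, extendFrom (Ioo a b) (fun t => toDisc (γ i t)) b = β i := fun i =>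
    eq_lim_at_right_extendFrom_Ioo hab (hβ1 i)
  have hint : ∀ t ∈ Ioo a b, (∀ i, discMap P (toDisc (γ i t)) = ρ * t) ∧
      ∀ x, discMap P x = ρ * t →
        (Finset.univ.filter fun i => toDisc (γ i t) = x).card = discMult P x := fun t ht =>
    discMap_toDisc_of_eq_prod hP hn hρ (ha.trans ht.1.le) (ht.2.trans_le hb) (hprod t ht)
  refine ⟨fun i => extendFrom (Ioo a b) fun t => toDisc (γ i t), fun i =>
    continuousOn_Icc_extendFrom_Ioo (hE i) (hα1 i) (hβ1 i), fun i t ht => ?_,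
    fun t ht i j hij => ?_, fun t ht x hx => ?_⟩
  · beta_reduce
    rcases eq_endpoints_or_mem_Ioo_of_mem_Icc ht with rfl | rfl | ht
    · rw [hδa, hα2]
    · rw [hδb, hβ2]
    · rw [hδ i t ht, (hint t ht).1]
  · simp only [hδ _ t ht] at hij
    exact hinj t ht (toDisc_injective hij)
  · rcases eq_endpoints_or_mem_Ioo_of_mem_Icc ht with rfl | rfl | ht
    · simp only [hδa, hα3 x hx]
    · simp only [hδb, hβ3 x hx]
    · simp only [hδ _ t ht, (hint t ht).2 x hx]

/-! ### Polynomials with concentrating increments -/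

theorem strictMonoOn_div_one_sub : StrictMonoOn (fun t : ℝ => t / (1 - t)) (Iio 1) := by
  intro a ha b hb hab
  have ha' : 0 < 1 - a := sub_pos.2 ha
  have hb' : 0 < 1 - b := sub_pos.2 hb
  simp only
  rw [div_lt_div_iff₀ ha' hb']
  linarith

theorem hasDerivAt_div_one_sub {t : ℝ} (ht : t < 1) :
    HasDerivAt (fun t : ℝ => t / (1 - t)) (((1 - t) ^ 2)⁻¹) t := by
  have h : 1 - t ≠ 0 := (sub_pos.2 ht).ne'
  convert! (hasDerivAt_id t).div ((hasDerivAt_const t (1 : ℝ)).sub (hasDerivAt_id t)) h using 1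
  simp

namespace Polynomial

/-- Polynomial primitives make the integrals along arcs depend on the end points only. -/
theorem exists_derivative_eq {k : Type*} [Field k] [CharZero k] (p : k[X]) :
    ∃ q : k[X], derivative q = p := by
  induction p using Polynomial.induction_on' with
  | add p q hp hq =>
    obtain ⟨p', rfl⟩ := hp
    obtain ⟨q', rfl⟩ := hq
    exact ⟨p' + q', derivative_add⟩
  | monomial n a =>
    refine ⟨monomial (n + 1) (a / (n + 1)), ?_⟩
    have : (n + 1 : k) ≠ 0 := by exact_mod_cast n.succ_ne_zero
    rw [derivative_monomial]
    simp [div_mul_cancel₀ _ this]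

/-- A continuous curve lifted through a polynomial is differentiable at regular points. -/
theorem hasDerivAt_of_eval_eq {P : ℂ[X]} {γ w : ℝ → ℂ} {w' : ℂ} {t : ℝ}
    (hγ : ContinuousAt γ t) (hw : HasDerivAt w w' t) (h : ∀ᶠ s in 𝓝 t, P.eval (γ s) = w s)
    (h0 : P.derivative.eval (γ t) ≠ 0) :
    HasDerivAt γ ((P.derivative.eval (γ t))⁻¹ * w') t := by
  have hs : HasStrictDerivAt (fun z => P.eval z) (P.derivative.eval (γ t)) (γ t) :=
    P.hasStrictDerivAt _
  have hinv := (hs.to_localInverse h0).hasDerivAt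
  have hPt : P.eval (γ t) = w t := h.self_of_nhds
  rw [hPt] at hinv
  have hcomp := hinv.comp t hw
  refine hcomp.congr_of_eventuallyEq ?_
  have hleft := hγ.eventually (hs.hasStrictFDerivAt_equiv h0).eventually_left_inverse
  filter_upwards [h, hleft] with s h1 h2
  rw [Function.comp, ← h1]
  exact h2.symm

end Polynomial

open MeasureTheory

/-- The chain rule gives `P'(γ) γ' = w'`, so the factor `P'` of `A'` cancels the denominator of
`γ'`. The remaining integrand is continuous up to the ends, which may therefore be critical points.
-/
theorem eval_sub_eval_eq_integral {P A L Q : ℂ[X]}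
    (hA : derivative A = derivative P * (L * Q.comp P)) {ρ : ℂ} {α β : ℝ} (hαβ : α ≤ β)
    (hβ : β < 1) {γ : ℝ → ℂ} (hγ : ContinuousOn γ (Icc α β))
    (hP : ∀ t ∈ Icc α β, P.eval (γ t) = ρ * (t / (1 - t) : ℝ))
    (hreg : ∀ t ∈ Ioo α β, P.derivative.eval (γ t) ≠ 0) :
    A.eval (γ β) - A.eval (γ α) = ∫ t in α..β,
      L.eval (γ t) * Q.eval (ρ * (t / (1 - t) : ℝ)) * (ρ * (((1 - t) ^ 2)⁻¹ : ℝ)) := by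
  have hr : ContinuousOn (fun t : ℝ => ρ * ((t / (1 - t) : ℝ) : ℂ)) (Icc α β) :=
    continuousOn_const.mul (Complex.continuous_ofReal.comp_continuousOn
      (continuousOn_div_one_sub.mono fun t ht => ht.2.trans_lt hβ))
  symm
  refine intervalIntegral.integral_eq_sub_of_hasDerivAt_of_le
    (f := fun t => A.eval (γ t)) hαβ (A.continuous.comp_continuousOn hγ) ?_ ?_
  · intro t ht
    have hw : HasDerivAt (fun t : ℝ => ρ * ((t / (1 - t) : ℝ) : ℂ))
        (ρ * (((1 - t) ^ 2)⁻¹ : ℝ)) t :=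
      ((hasDerivAt_div_one_sub (ht.2.trans hβ)).ofReal_comp).const_mul ρ
    have hd := hasDerivAt_of_eval_eq (P := P) (hγ.continuousAt (Icc_mem_nhds ht.1 ht.2)) hw
      (by filter_upwards [Icc_mem_nhds ht.1 ht.2] with s hs using hP s hs) (hreg t ht)
    refine (((A.hasDerivAt (γ t)).comp t hd)).congr_deriv ?_
    have h0 := hreg t ht
    rw [hA]
    simp only [eval_mul, eval_comp, hP t (Ioo_subset_Icc_self ht)]
    field_simp
  · refine ContinuousOn.intervalIntegrable ?_
    rw [uIcc_of_le hαβ]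
    refine ((L.continuous.comp_continuousOn hγ).mul (Q.continuous.comp_continuousOn hr)).mul
      (continuousOn_const.mul (Complex.continuous_ofReal.comp_continuousOn ?_))
    refine ContinuousOn.inv₀ (by fun_prop) fun t ht => ?_
    have : 0 < 1 - t := sub_pos.2 (ht.2.trans_lt hβ)
    positivity

/-- Polynomials whose increments along curves over the coordinate axes concentrate at a
single regular point `γ₀` over the parameter `t₀`. -/
theorem exists_concentrating_polynomials {P : ℂ[X]} {T t₀ : ℝ} (ht₀ : t₀ ∈ Ioo 0 T) (hT : T < 1)
    {ρ₀ γ₀ : ℂ} (hρ₀ : ρ₀ ^ 4 = 1) (hγ₀ : P.eval γ₀ = ρ₀ * (t₀ / (1 - t₀) : ℝ))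
    (hreg₀ : P.derivative.eval γ₀ ≠ 0) :
    ∃ F : ℕ → ℂ[X], ∀ (ρ : ℂ) (α β : ℝ) (γ : ℝ → ℂ), ρ ^ 4 = 1 → 0 ≤ α → α ≤ β → β ≤ T →
      ContinuousOn γ (Icc α β) → (∀ t ∈ Icc α β, P.eval (γ t) = ρ * (t / (1 - t) : ℝ)) →
      (∀ t ∈ Ioo α β, P.derivative.eval (γ t) ≠ 0) →
      ((t₀ ∉ Icc α β ∨ t₀ ∈ Ioo α β ∧ (ρ = ρ₀ → γ t₀ ≠ γ₀)) →
        Tendsto (fun N => (F N).eval (γ β) - (F N).eval (γ α)) atTop (𝓝 0)) ∧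
      (t₀ ∈ Ioo α β → ρ = ρ₀ → γ t₀ = γ₀ →
        ∃ c ≠ 0, Tendsto (fun N => (F N).eval (γ β) - (F N).eval (γ α)) atTop (𝓝 c)) := by
  have hT0 : 0 < T := ht₀.1.trans ht₀.2
  have ht₁ : t₀ < 1 := ht₀.2.trans hT
  have hρ₀0 : ρ₀ ≠ 0 := by rintro rfl; norm_num at hρ₀
  set r₀ : ℝ := t₀ / (1 - t₀) with hr₀
  have hr₀pos : 0 < r₀ := div_pos ht₀.1 (sub_pos.2 ht₁)
  have hr₀C : (r₀ : ℂ) ≠ 0 := by exact_mod_cast hr₀pos.ne'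
  set w₀ : ℂ := ρ₀ * r₀ with hw₀
  have hw₀0 : w₀ ≠ 0 := mul_ne_zero hρ₀0 hr₀C
  -- the Lagrange factor
  obtain ⟨L, hL⟩ : X - C γ₀ ∣ P - C w₀ := by
    rw [dvd_iff_isRoot]; simp [hγ₀]
  have hL0 : L.eval γ₀ ≠ 0 := by
    have := congrArg (fun p => (derivative p).eval γ₀) hL
    simp at this
    rwa [← this]
  have hLz : ∀ z, P.eval z = w₀ → z ≠ γ₀ → L.eval z = 0 := by
    intro z hz hne
    have := congrArg (eval z) hL
    simp only [eval_sub, eval_C, hz, sub_self, eval_mul, eval_X] at this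
    exact (mul_eq_zero.1 this.symm).resolve_left (sub_ne_zero.2 hne)
  -- the factor killing the other rays
  set S : ℂ[X] := ∑ k ∈ Finset.range 4, (C w₀⁻¹ * X) ^ k with hS
  have hSev : ∀ ρ : ℂ, S.eval (ρ * r₀) = ∑ k ∈ Finset.range 4, (ρ / ρ₀) ^ k := by
    intro ρ
    rw [hS, eval_finsetSum]
    refine Finset.sum_congr rfl fun k _ => ?_
    simp only [eval_pow, eval_mul, eval_C, eval_X]
    congr 1
    rw [hw₀]
    field_simp
  have hS0 : S.eval (ρ₀ * r₀) ≠ 0 := by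
    rw [hSev, div_self hρ₀0]; norm_num
  have hSρ : ∀ ρ : ℂ, ρ ^ 4 = 1 → ρ ≠ ρ₀ → S.eval (ρ * r₀) = 0 := by
    intro ρ hρ hne
    have h1 := geom_sum_mul (ρ / ρ₀) 4
    rw [div_pow, hρ, hρ₀, div_one, sub_self] at h1
    rw [hSev]
    refine (mul_eq_zero.1 h1).resolve_right ?_
    rw [sub_eq_zero, div_eq_one_iff_eq hρ₀0]
    exact hne
  -- the peak
  let r : ℝ → ℝ := fun t => t / (1 - t)
  -- This bound exceeds every `|r t ^ 4 - r₀ ^ 4|` on `[0, T]`, which keeps the peak function `c`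
  -- between `0` and `1`.
  set B : ℝ := r T ^ 4 + 1 with hB
  have hBpos : 0 < B := by positivity
  -- Only fourth powers enter, so `K` has the same real profile `c` on all four half-axes, with its
  -- unique maximum at `t₀`.
  set K : ℂ[X] := 1 - (C (B⁻¹ : ℂ) * (X ^ 4 - C ((r₀ : ℂ) ^ 4))) ^ 2 with hK
  let c : ℝ → ℝ := fun t => 1 - (B⁻¹ * (r t ^ 4 - r₀ ^ 4)) ^ 2
  have hKc : ∀ ρ : ℂ, ρ ^ 4 = 1 → ∀ t : ℝ, K.eval (ρ * (t / (1 - t) : ℝ)) = c t := by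
    intro ρ hρ t
    simp only [hK, eval_sub, eval_one, eval_pow, eval_mul, eval_C, eval_X, mul_pow ρ, hρ, one_mul]
    simp only [c, r]
    push_cast
    ring
  have hrcont : ContinuousOn r (Iio 1) := continuousOn_div_one_sub
  have hccont : ContinuousOn c (Icc 0 T) := by
    have : ContinuousOn r (Icc 0 T) := hrcont.mono fun t ht => ht.2.trans_lt hT
    fun_prop
  have hrnn : ∀ t ∈ Icc 0 T, 0 ≤ r t := fun t ht =>
    div_nonneg ht.1 (sub_pos.2 (ht.2.trans_lt hT)).le
  have hrT : ∀ t ∈ Icc 0 T, r t ^ 4 ≤ r T ^ 4 := fun t ht =>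
    pow_le_pow_left₀ (hrnn t ht) (strictMonoOn_div_one_sub.monotoneOn (ht.2.trans_lt hT) hT ht.2) 4
  have hc0 : c t₀ = 1 := by simp [c, r, hr₀]
  have hclt : ∀ t ∈ Icc 0 T, t ≠ t₀ → c t < c t₀ := by
    intro t ht hne
    rw [hc0]
    have h1 : r t ≠ r₀ := fun h =>
      hne (strictMonoOn_div_one_sub.injOn (ht.2.trans_lt hT) ht₁ h)
    have h2 : r t ^ 4 - r₀ ^ 4 ≠ 0 := by
      rw [sub_ne_zero]
      exact fun h => h1 ((pow_left_inj₀ (hrnn t ht) hr₀pos.le four_ne_zero).1 h)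
    have : 0 < (B⁻¹ * (r t ^ 4 - r₀ ^ 4)) ^ 2 := by positivity
    simp only [c]; linarith
  have hcnn : ∀ t ∈ Icc 0 T, 0 ≤ c t := by
    intro t ht
    have h1 := hrT t ht
    have h2 : r₀ ^ 4 ≤ r T ^ 4 := hrT t₀ ⟨ht₀.1.le, ht₀.2.le⟩
    have h3 : 0 ≤ r t ^ 4 := pow_nonneg (hrnn t ht) 4
    have h4 : 0 ≤ r₀ ^ 4 := by positivity
    have : |B⁻¹ * (r t ^ 4 - r₀ ^ 4)| ≤ 1 := by
      rw [abs_mul, abs_of_pos (inv_pos.2 hBpos), inv_mul_le_iff₀ hBpos, mul_one, abs_le]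
      constructor <;> linarith
    have := (sq_le_one_iff_abs_le_one _).2 this
    simp only [c]; linarith
  -- Divided by `∫ c ^ N`, the increments become averages against an approximate identity at `t₀`.
  choose A hA using fun N : ℕ => exists_derivative_eq (derivative P * (L * (K ^ N * S).comp P))
  refine ⟨fun N => C (((∫ t in Icc 0 T, c t ^ N)⁻¹ : ℝ) : ℂ) * A N,
    fun ρ α β γ hρ hα hαβ hβ hγ hP hreg => ?_⟩
  let g₁ : ℝ → ℂ := fun t =>
    L.eval (γ t) * S.eval (ρ * (t / (1 - t) : ℝ)) * (ρ * (((1 - t) ^ 2)⁻¹ : ℝ))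
  -- Extension by zero puts all arcs on the common interval `[0, T]`; the limit of the increments is
  -- then `g t₀`.
  let g : ℝ → ℂ := (Icc α β).indicator g₁
  have hg₁ : ContinuousOn g₁ (Icc α β) := by
    have hr : ContinuousOn (fun t : ℝ => ρ * ((t / (1 - t) : ℝ) : ℂ)) (Icc α β) :=
      continuousOn_const.mul (Complex.continuous_ofReal.comp_continuousOn
        (hrcont.mono fun t ht => ht.2.trans_lt (hβ.trans_lt hT)))
    refine ((L.continuous.comp_continuousOn hγ).mul (S.continuous.comp_continuousOn hr)).mul
      (continuousOn_const.mul (Complex.continuous_ofReal.comp_continuousOn ?_))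
    refine ContinuousOn.inv₀ (by fun_prop) fun t ht => ?_
    have : 0 < 1 - t := sub_pos.2 (ht.2.trans_lt (hβ.trans_lt hT))
    positivity
  have hgint : IntegrableOn g (Icc 0 T) :=
    ((integrable_indicator_iff measurableSet_Icc).2 (hg₁.integrableOn_compact isCompact_Icc)
      ).integrableOn
  have hev : ∀ N, (C (((∫ t in Icc 0 T, c t ^ N)⁻¹ : ℝ) : ℂ) * A N).eval (γ β) -
      (C (((∫ t in Icc 0 T, c t ^ N)⁻¹ : ℝ) : ℂ) * A N).eval (γ α) =
      (∫ t in Icc 0 T, c t ^ N)⁻¹ • ∫ t in Icc 0 T, c t ^ N • g t := by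
    intro N
    have h1 := eval_sub_eval_eq_integral (hA N) hαβ (hβ.trans_lt hT) hγ hP hreg
    have h2 : ∀ t, c t ^ N • g t = (Icc α β).indicator (fun t => c t ^ N • g₁ t) t := by
      intro t
      simp only [g, indicator]
      split_ifs <;> simp
    simp only [eval_mul, eval_C]
    rw [← mul_sub, h1, ← Complex.real_smul]
    congr 1
    simp only [h2]
    rw [setIntegral_indicator measurableSet_Icc, inter_eq_right.2 (Icc_subset_Icc hα hβ),
      intervalIntegral.integral_of_le hαβ, integral_Icc_eq_integral_Ioc]
    refine integral_congr_ae (ae_of_all _ fun t => ?_)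
    simp only [g₁, eval_mul, eval_pow, hKc ρ hρ, Complex.real_smul]
    push_cast
    ring
  have hlim : ContinuousWithinAt g (Icc 0 T) t₀ → Tendsto (fun N =>
      (C (((∫ t in Icc 0 T, c t ^ N)⁻¹ : ℝ) : ℂ) * A N).eval (γ β) -
      (C (((∫ t in Icc 0 T, c t ^ N)⁻¹ : ℝ) : ℂ) * A N).eval (γ α)) atTop (𝓝 (g t₀)) := by
    intro hg
    simp only [hev]
    refine tendsto_setIntegral_pow_smul_of_unique_maximum_of_isCompact_of_integrableOn
      isCompact_Icc hccont hclt hcnn (by rw [hc0]; exact one_pos) ?_ hgint hg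
    rw [interior_Icc]
    exact subset_closure ht₀
  have hin : t₀ ∈ Ioo α β → ContinuousWithinAt g (Icc 0 T) t₀ ∧ g t₀ = g₁ t₀ := by
    intro h
    have hm := Icc_mem_nhds h.1 h.2
    refine ⟨((hg₁.continuousAt hm).congr ?_).continuousWithinAt,
      indicator_of_mem (Ioo_subset_Icc_self h) _⟩
    filter_upwards [hm] with t ht
    exact (indicator_of_mem ht _).symm
  -- The limit vanishes for three reasons: `t₀` is outside the parameter range, `L` kills another
  -- point over `w₀`, or `S` kills another half-axis.
  refine ⟨?_, fun h hρρ hγγ => ?_⟩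
  · rintro (h | ⟨h, hne⟩)
    · have h0 : g t₀ = 0 := indicator_of_notMem h _
      rw [← h0]
      refine hlim (ContinuousAt.continuousWithinAt ?_)
      refine (continuousAt_const (y := (0 : ℂ))).congr ?_
      filter_upwards [isClosed_Icc.isOpen_compl.mem_nhds h] with t ht
      exact (indicator_of_notMem ht _).symm
    · obtain ⟨h1, h2⟩ := hin h
      have h0 : g t₀ = 0 := by
        rw [h2]
        by_cases hρρ : ρ = ρ₀
        · have := hLz (γ t₀) (by rw [hP t₀ ⟨h.1.le, h.2.le⟩, hρρ]) (hne hρρ)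
          simp only [g₁, this, zero_mul]
        · have := hSρ ρ hρ hρρ
          rw [hr₀] at this
          simp only [g₁, this, mul_zero, zero_mul]
      rw [← h0]
      exact hlim h1
  · obtain ⟨h1, h2⟩ := hin h
    refine ⟨g t₀, ?_, hlim h1⟩
    rw [h2]
    have h3 : 0 < 1 - t₀ := sub_pos.2 ht₁
    have h4 : (((1 - t₀) ^ 2)⁻¹ : ℝ) ≠ 0 := by positivity
    simp only [g₁, hγγ, hρρ]
    exact mul_ne_zero (mul_ne_zero hL0 (by rw [hr₀] at hS0; exact hS0))
      (mul_ne_zero hρ₀0 (by exact_mod_cast h4))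

/-! ### Subdivision of the half-axes and the system of arcs -/

theorem exists_unitInterval_partition (S : Finset ℝ) :
    ∃ (M : ℕ) (t : Fin (M + 2) → ℝ), StrictMono t ∧ t 0 = 0 ∧ t (Fin.last _) = 1 ∧
      ∀ j : Fin (M + 1), ∀ s ∈ Ioo (t j.castSucc) (t j.succ), s ∉ S := by
  set S' : Finset ℝ := insert 0 (insert 1 (S.filter (· ∈ Ioo (0 : ℝ) 1))) with hS'
  have h01 : ({0, 1} : Finset ℝ) ⊆ S' := by
    intro x hx
    simp only [Finset.mem_insert, Finset.mem_singleton] at hx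
    rcases hx with rfl | rfl <;> simp [hS']
  have hcard : 2 ≤ S'.card := by
    have := Finset.card_le_card h01
    rwa [Finset.card_pair zero_ne_one] at this
  obtain ⟨M, hM⟩ := Nat.exists_eq_add_of_le' hcard
  let t := S'.orderEmbOfFin hM
  have hmem : ∀ x ∈ S', 0 ≤ x ∧ x ≤ 1 := by
    intro x hx
    simp only [hS', Finset.mem_insert, Finset.mem_filter, mem_Ioo] at hx
    rcases hx with rfl | rfl | ⟨-, h1, h2⟩
    · simp
    · simp
    · exact ⟨h1.le, h2.le⟩
  have hrange : ∀ x ∈ S', ∃ i, t i = x := by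
    intro x hx
    have : x ∈ Set.range t := by rw [Finset.range_orderEmbOfFin]; exact hx
    exact this
  refine ⟨M, t, t.strictMono, ?_, ?_, fun j s hs hsS => ?_⟩
  · obtain ⟨i, hi⟩ := hrange 0 (h01 (by simp))
    refine le_antisymm ?_ (hmem _ (S'.orderEmbOfFin_mem hM 0)).1
    rw [← hi]; exact t.monotone (Fin.zero_le i)
  · obtain ⟨i, hi⟩ := hrange 1 (h01 (by simp))
    refine le_antisymm (hmem _ (S'.orderEmbOfFin_mem hM _)).2 ?_
    rw [← hi]; exact t.monotone (Fin.le_last i)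
  · have h0 : 0 < s := (hmem _ (S'.orderEmbOfFin_mem hM _)).1.trans_lt hs.1
    have h1 : s < 1 := hs.2.trans_le (hmem _ (S'.orderEmbOfFin_mem hM _)).2
    obtain ⟨i, rfl⟩ := hrange s (by simp [hS', hsS, h0, h1])
    have h2 := t.lt_iff_lt.1 hs.1
    have h3 := t.lt_iff_lt.1 hs.2
    simp only [Fin.lt_def, Fin.val_castSucc, Fin.val_succ] at h2 h3
    omega

/-- The four unit directions of the coordinate axes. -/
noncomputable def axisDir (k : Fin 4) : ℂ := Complex.I ^ (k : ℕ)

theorem norm_axisDir (k : Fin 4) : ‖axisDir k‖ = 1 := by simp [axisDir]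

theorem axisDir_pow_four (k : Fin 4) : axisDir k ^ 4 = 1 := by
  rw [axisDir, ← pow_mul, mul_comm, pow_mul, Complex.I_pow_four, one_pow]

theorem axisDir_zero : axisDir 0 = 1 := by simp [axisDir]
theorem axisDir_one : axisDir 1 = Complex.I := by simp [axisDir]
theorem axisDir_two : axisDir 2 = -1 := by simp [axisDir]
theorem axisDir_three : axisDir 3 = -Complex.I := by
  simp [axisDir, pow_succ]

theorem axisDir_injective : Function.Injective axisDir := by
  intro a b h
  -- The functional `re + 3 * im` separates the four directions, with values `1, 3, -1, -3`.
  have h3 : (axisDir a).re - (axisDir b).re + 3 * ((axisDir a).im - (axisDir b).im) = 0 := by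
    rw [h]; ring
  clear h
  fin_cases a <;> fin_cases b <;>
    simp [axisDir_zero, axisDir_one, axisDir_two, axisDir_three] at h3 ⊢ <;> norm_num at h3

theorem exists_axisDir_of_pow_four {x : ℂ} (hx : x ^ 4 = 1) : ∃ k, axisDir k = x := by
  have : (x - 1) * (x + 1) * ((x - Complex.I) * (x + Complex.I)) = 0 := by
    linear_combination hx - (x ^ 2 - 1) * Complex.I_sq
  rcases mul_eq_zero.1 this with h | h <;> rcases mul_eq_zero.1 h with h | h
  · exact ⟨0, by rw [axisDir_zero]; exact (sub_eq_zero.1 h).symm⟩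
  · exact ⟨2, by rw [axisDir_two]; exact (eq_neg_of_add_eq_zero_left h).symm⟩
  · exact ⟨1, by rw [axisDir_one]; exact (sub_eq_zero.1 h).symm⟩
  · exact ⟨3, by rw [axisDir_three]; exact (eq_neg_of_add_eq_zero_left h).symm⟩

theorem exists_axisDir_mul_of_mem_axes {w : ℂ} (hw : w.re = 0 ∨ w.im = 0) :
    ∃ k, ∃ r : ℝ, 0 ≤ r ∧ w = axisDir k * r := by
  rcases hw with h | h
  · rcases le_total 0 w.im with h0 | h0
    · exact ⟨1, w.im, h0, by rw [axisDir_one]; apply Complex.ext <;> simp [h]⟩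
    · exact ⟨3, -w.im, by linarith, by rw [axisDir_three]; apply Complex.ext <;> simp [h]⟩
  · rcases le_total 0 w.re with h0 | h0
    · exact ⟨0, w.re, h0, by rw [axisDir_zero]; apply Complex.ext <;> simp [h]⟩
    · exact ⟨2, -w.re, by linarith, by rw [axisDir_two]; apply Complex.ext <;> simp [h]⟩

theorem axisDir_mul_re_or_im (k : Fin 4) :
    (∀ r : ℝ, (axisDir k * r).re = 0) ∨ ∀ r : ℝ, (axisDir k * r).im = 0 := by
  fin_cases k
  · right; simp [axisDir_zero]
  · left; simp [axisDir_one]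
  · right; simp [axisDir_two]
  · left; simp [axisDir_three]

theorem axisDir_mul_eq_iff {k k' : Fin 4} {s s' : ℝ} (hs : 0 ≤ s) (hs' : 0 ≤ s') :
    axisDir k * s = axisDir k' * s' ↔ s = s' ∧ (s = 0 ∨ k = k') := by
  constructor
  · intro h
    have hn := congrArg norm h
    simp only [norm_mul, norm_axisDir, one_mul, Complex.norm_of_nonneg hs,
      Complex.norm_of_nonneg hs'] at hn
    subst hn
    refine ⟨rfl, or_iff_not_imp_left.2 fun h0 => axisDir_injective ?_⟩
    exact mul_right_cancel₀ (by exact_mod_cast h0) h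
  · rintro ⟨rfl, rfl | rfl⟩ <;> simp

/-- The arcs over the coordinate axes into which the harmonic web of `P` decomposes, drawn in
the closed disc and parametrized by the modulus of `discMap P`. -/
structure ArcSystem (P : ℂ[X]) where
  M : ℕ
  t : Fin (M + 2) → ℝ
  strictMono_t : StrictMono t
  t_zero : t 0 = 0
  t_last : t (Fin.last _) = 1
  reg : ∀ j : Fin (M + 1), ∀ s ∈ Ioo (t j.castSucc) (t j.succ), ∀ z,
    P.derivative.eval z = 0 → ∀ k, P.eval z ≠ axisDir k * (s / (1 - s) : ℝ)
  curve : Fin 4 → Fin (M + 1) → Fin P.natDegree → ℝ → ℂ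
  continuousOn_curve : ∀ k j i, ContinuousOn (curve k j i) (Icc (t j.castSucc) (t j.succ))
  discMap_curve : ∀ k j i, ∀ s ∈ Icc (t j.castSucc) (t j.succ),
    discMap P (curve k j i s) = axisDir k * s
  injective_curve : ∀ k j, ∀ s ∈ Ioo (t j.castSucc) (t j.succ),
    Function.Injective fun i => curve k j i s
  card_curve : ∀ k j, ∀ s ∈ Icc (t j.castSucc) (t j.succ), ∀ x, discMap P x = axisDir k * s →
    (Finset.univ.filter fun i => curve k j i s = x).card = discMult P x

theorem nonempty_arcSystem {P : ℂ[X]} (hP : 0 < P.natDegree) : Nonempty (ArcSystem P) := by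
  have hP' : derivative P ≠ 0 := fun h => hP.ne' (derivative_eq_zero.1 h)
  -- Break points come from all critical values, also those off the axes: one subdivision serves all
  -- four half-axes, and superfluous nodes have even valency.
  obtain ⟨M, t, ht, h0, h1, hS⟩ := exists_unitInterval_partition
    ((derivative P).roots.toFinset.image fun z => ‖P.eval z‖ / (1 + ‖P.eval z‖))
  have hnn : ∀ m, 0 ≤ t m := fun m => h0 ▸ ht.monotone (Fin.zero_le m)
  have hle : ∀ m, t m ≤ 1 := fun m => h1 ▸ ht.monotone (Fin.le_last m)
  have hreg : ∀ j : Fin (M + 1), ∀ s ∈ Ioo (t j.castSucc) (t j.succ), ∀ z,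
      P.derivative.eval z = 0 → ∀ k, P.eval z ≠ axisDir k * (s / (1 - s) : ℝ) := by
    intro j s hs z hz k hk
    refine hS j s hs (Finset.mem_image.2 ⟨z, ?_, ?_⟩)
    · rw [Multiset.mem_toFinset, mem_roots hP']; exact hz
    · have hs1 : 0 < 1 - s := sub_pos.2 (hs.2.trans_le (hle _))
      have hs0 : 0 ≤ s := (hnn _).trans hs.1.le
      rw [hk, norm_mul, norm_axisDir, one_mul, Complex.norm_of_nonneg (by positivity)]
      field_simp
      ring
  choose δ hδ1 hδ2 hδ3 hδ4 using fun (k : Fin 4) (j : Fin (M + 1)) =>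
    exists_disc_curves rfl hP (hnn j.castSucc) (ht j.castSucc_lt_succ) (hle j.succ)
      (norm_axisDir k) fun s hs z hz => hreg j s hs z hz k
  exact ⟨⟨M, t, ht, h0, h1, hreg, δ, hδ1, hδ2, hδ3, hδ4⟩⟩

namespace ArcSystem

variable {P : ℂ[X]} (A : ArcSystem P)

/-- The index set of the arcs. -/
abbrev Edge : Type := Fin 4 × Fin (A.M + 1) × Fin P.natDegree

/-- The starting point of an arc. -/
noncomputable def src (e : A.Edge) : ℂ := A.curve e.1 e.2.1 e.2.2 (A.t e.2.1.castSucc)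

/-- The end point of an arc. -/
noncomputable def tgt (e : A.Edge) : ℂ := A.curve e.1 e.2.1 e.2.2 (A.t e.2.1.succ)

theorem t_nonneg (m : Fin (A.M + 2)) : 0 ≤ A.t m :=
  A.t_zero ▸ A.strictMono_t.monotone (Fin.zero_le m)

theorem t_le_one (m : Fin (A.M + 2)) : A.t m ≤ 1 :=
  A.t_last ▸ A.strictMono_t.monotone (Fin.le_last m)

theorem t_castSucc_lt_succ (j : Fin (A.M + 1)) : A.t j.castSucc < A.t j.succ :=
  A.strictMono_t j.castSucc_lt_succ

theorem t_castSucc_lt_one (j : Fin (A.M + 1)) : A.t j.castSucc < 1 :=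
  (A.t_castSucc_lt_succ j).trans_le (A.t_le_one _)

theorem t_eq_zero_iff {m : Fin (A.M + 2)} : A.t m = 0 ↔ m = 0 := by
  rw [← A.t_zero]; exact A.strictMono_t.injective.eq_iff

theorem t_eq_one_iff {m : Fin (A.M + 2)} : A.t m = 1 ↔ m = Fin.last _ := by
  rw [← A.t_last]; exact A.strictMono_t.injective.eq_iff

theorem discMap_src (e : A.Edge) : discMap P (A.src e) = axisDir e.1 * A.t e.2.1.castSucc :=
  A.discMap_curve _ _ _ _ (left_mem_Icc.2 (A.t_castSucc_lt_succ _).le)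

theorem discMap_tgt (e : A.Edge) : discMap P (A.tgt e) = axisDir e.1 * A.t e.2.1.succ :=
  A.discMap_curve _ _ _ _ (right_mem_Icc.2 (A.t_castSucc_lt_succ _).le)

theorem norm_discMap_curve (k : Fin 4) (j : Fin (A.M + 1)) (i : Fin P.natDegree) {s : ℝ}
    (hs : s ∈ Icc (A.t j.castSucc) (A.t j.succ)) : ‖discMap P (A.curve k j i s)‖ = s := by
  rw [A.discMap_curve k j i s hs, norm_mul, norm_axisDir, one_mul,
    Complex.norm_of_nonneg ((A.t_nonneg _).trans hs.1)]

theorem norm_discMap_src (e : A.Edge) : ‖discMap P (A.src e)‖ = A.t e.2.1.castSucc :=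
  A.norm_discMap_curve _ _ _ (left_mem_Icc.2 (A.t_castSucc_lt_succ _).le)

theorem norm_discMap_tgt (e : A.Edge) : ‖discMap P (A.tgt e)‖ = A.t e.2.1.succ :=
  A.norm_discMap_curve _ _ _ (right_mem_Icc.2 (A.t_castSucc_lt_succ _).le)

theorem natDegree_pos (e : A.Edge) : 0 < P.natDegree := e.2.2.pos

theorem ne_zero_of_edge (e : A.Edge) : P ≠ 0 := by
  rintro rfl; simpa using A.natDegree_pos e

theorem exists_curve_eq (hP : 0 < P.natDegree) (k : Fin 4) (j : Fin (A.M + 1)) {s : ℝ}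
    (hs : s ∈ Icc (A.t j.castSucc) (A.t j.succ)) {x : ℂ} (hx : discMap P x = axisDir k * s) :
    ∃ i, A.curve k j i s = x := by
  have h := A.card_curve k j s hs x hx
  have hpos := discMult_pos hP x
  rw [← h, Finset.card_pos] at hpos
  obtain ⟨i, hi⟩ := hpos
  exact ⟨i, (Finset.mem_filter.1 hi).2⟩

/-- On the circle the local degree is one, so a single arc arrives. -/
theorem eq_of_tgt_eq_of_norm {e f : A.Edge} (h : A.tgt e = A.tgt f) (hn : ‖A.tgt e‖ = 1) :
    e = f := by
  obtain ⟨k, j, i⟩ := e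
  obtain ⟨k', j', i'⟩ := f
  have h1 := congrArg (discMap P) h
  rw [discMap_tgt, discMap_tgt, axisDir_mul_eq_iff (A.t_nonneg _) (A.t_nonneg _)] at h1
  obtain ⟨hj, hk⟩ := h1
  obtain rfl : j = j' := Fin.succ_injective _ (A.strictMono_t.injective hj)
  obtain rfl : k = k' := hk.resolve_left fun h0 => j.succ_ne_zero (A.t_eq_zero_iff.1 h0)
  have hc := A.card_curve k j _ (right_mem_Icc.2 (A.t_castSucc_lt_succ j).le) _
    (A.discMap_tgt (k, j, i))
  rw [discMult, if_neg hn.ge.not_gt, Finset.card_eq_one] at hc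
  obtain ⟨a, ha⟩ := hc
  have hi : i ∈ ({a} : Finset _) := by
    rw [← ha]; exact Finset.mem_filter.2 ⟨Finset.mem_univ _, rfl⟩
  have hi' : i' ∈ ({a} : Finset _) := by
    rw [← ha]; exact Finset.mem_filter.2 ⟨Finset.mem_univ _, h.symm⟩
  rw [Finset.mem_singleton] at hi hi'
  rw [hi, hi']

/-- For every arc there are functions on the vertices whose increments concentrate on it. -/
theorem exists_potential (e₀ : A.Edge) :
    ∃ Φ : ℕ → ℂ → ℂ,
      (∀ e, e ≠ e₀ → Tendsto (fun N => Φ N (A.tgt e) - Φ N (A.src e)) atTop (𝓝 0)) ∧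
      ∃ c ≠ 0, Tendsto (fun N => Φ N (A.tgt e₀) - Φ N (A.src e₀)) atTop (𝓝 c) := by
  classical
  have hP0 := A.ne_zero_of_edge e₀
  have hdeg := A.natDegree_pos e₀
  -- Cutting at `T`, beyond the last break point below `1`, shortens only the arcs running to
  -- infinity, where polynomials have no values.
  obtain ⟨T, hMT, hT⟩ := exists_between (A.t_castSucc_lt_one (Fin.last A.M))
  have hjT : ∀ j : Fin (A.M + 1), A.t j.castSucc < T := fun j =>
    (A.strictMono_t.monotone (Fin.castSucc_le_castSucc_iff.2 (Fin.le_last j))).trans_lt hMT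
  let β : Fin (A.M + 1) → ℝ := fun j => min (A.t j.succ) T
  have hβ : ∀ j, A.t j.castSucc < β j := fun j => lt_min (A.t_castSucc_lt_succ j) (hjT j)
  have hβT : ∀ j, β j ≤ T := fun j => min_le_right _ _
  have hβ1 : ∀ j, β j < 1 := fun j => (hβT j).trans_lt hT
  have hβs : ∀ j, Icc (A.t j.castSucc) (β j) ⊆ Icc (A.t j.castSucc) (A.t j.succ) := fun j =>
    Icc_subset_Icc_right (min_le_left _ _)
  let γ : A.Edge → ℝ → ℂ := fun e s => fromDisc (A.curve e.1 e.2.1 e.2.2 s)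
  have hlt : ∀ e : A.Edge, ∀ s ∈ Icc (A.t e.2.1.castSucc) (β e.2.1),
      ‖A.curve e.1 e.2.1 e.2.2 s‖ < 1 := fun e s hs =>
    norm_lt_one_of_discMap hP0 (norm_axisDir _) ((A.t_nonneg _).trans hs.1)
      (hs.2.trans_lt (hβ1 _)) (A.discMap_curve _ _ _ _ (hβs _ hs))
  have hPγ : ∀ e : A.Edge, ∀ s ∈ Icc (A.t e.2.1.castSucc) (β e.2.1),
      P.eval (γ e s) = axisDir e.1 * (s / (1 - s) : ℝ) := fun e s hs =>
    eval_fromDisc_of_discMap hP0 (norm_axisDir _) ((A.t_nonneg _).trans hs.1)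
      (hs.2.trans_lt (hβ1 _)) (A.discMap_curve _ _ _ _ (hβs _ hs))
  have hγc : ∀ e : A.Edge, ContinuousOn (γ e) (Icc (A.t e.2.1.castSucc) (β e.2.1)) := fun e =>
    continuousOn_fromDisc.comp ((A.continuousOn_curve _ _ _).mono (hβs _)) fun s hs =>
      mem_ball_zero_iff.2 (hlt e s hs)
  have hγreg : ∀ e : A.Edge, ∀ s ∈ Ioo (A.t e.2.1.castSucc) (β e.2.1),
      P.derivative.eval (γ e s) ≠ 0 := fun e s hs h =>
    A.reg e.2.1 s ⟨hs.1, hs.2.trans_le (min_le_left _ _)⟩ _ h e.1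
      (hPγ e s (Ioo_subset_Icc_self hs))
  obtain ⟨t₀, ht₀⟩ := nonempty_Ioo.2 (hβ e₀.2.1)
  have ht₀m := Ioo_subset_Icc_self ht₀
  obtain ⟨F, hF⟩ := exists_concentrating_polynomials
    ⟨(A.t_nonneg _).trans_lt ht₀.1, ht₀.2.trans_le (hβT _)⟩ hT (axisDir_pow_four e₀.1)
    (hPγ e₀ t₀ ht₀m) (hγreg e₀ t₀ ht₀)
  -- A boundary vertex gets the value at the cut end of its only arc. The final `0` is never used at
  -- a vertex.
  let Φ : ℕ → ℂ → ℂ := fun N v =>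
    if ‖v‖ < 1 then (F N).eval (fromDisc v)
    else if h : ∃ e, A.tgt e = v then (F N).eval (γ h.choose (β h.choose.2.1)) else 0
  have hΦs : ∀ N e, Φ N (A.src e) = (F N).eval (γ e (A.t e.2.1.castSucc)) := fun N e =>
    if_pos (hlt e _ (left_mem_Icc.2 (hβ _).le))
  have hΦt : ∀ N e, Φ N (A.tgt e) = (F N).eval (γ e (β e.2.1)) := by
    intro N e
    by_cases hv : ‖A.tgt e‖ < 1
    · have h1 : A.t e.2.1.succ ≠ 1 := fun h1 => by
        have := norm_discMap_lt_one (P := P) hv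
        rw [norm_discMap_tgt, h1] at this
        exact this.false
      have h2 : e.2.1.succ ≤ (Fin.last A.M).castSucc := by
        rw [Fin.le_castSucc_iff]
        rw [ne_eq, t_eq_one_iff] at h1
        exact Fin.lt_last_iff_ne_last.2 h1
      have h3 : β e.2.1 = A.t e.2.1.succ :=
        min_eq_left ((A.strictMono_t.monotone h2).trans hMT.le)
      simp only [Φ, if_pos hv, h3]
      rfl
    · have hn : ‖A.tgt e‖ = 1 := by
        refine norm_eq_one_of_norm_discMap hdeg ?_
        refine le_antisymm (by rw [norm_discMap_tgt]; exact A.t_le_one _) ?_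
        by_contra! hlt
        exact hv (norm_lt_one_of_norm_discMap_lt hP0 hlt)
      have hex : ∃ f, A.tgt f = A.tgt e := ⟨e, rfl⟩
      have hce : hex.choose = e :=
        (A.eq_of_tgt_eq_of_norm hex.choose_spec.symm hn).symm
      simp only [Φ, if_neg hv, dif_pos hex]
      rw [hce]
  refine ⟨Φ, fun e he => ?_, ?_⟩
  · simp only [hΦs, hΦt]
    refine (hF (axisDir e.1) (A.t e.2.1.castSucc) (β e.2.1) (γ e) (axisDir_pow_four _)
      (A.t_nonneg _) (hβ _).le (hβT _) (hγc e) (hPγ e) (hγreg e)).1 ?_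
    -- Over the same segment, arcs are separated at `t₀` by ray or by injectivity; over another
    -- segment, `t₀` is not a parameter.
    by_cases hj : e.2.1 = e₀.2.1
    · refine Or.inr ⟨hj ▸ ht₀, fun hk hγ => he ?_⟩
      have hk' := axisDir_injective hk
      have hm : t₀ ∈ Icc (A.t e.2.1.castSucc) (β e.2.1) := hj ▸ ht₀m
      have h1 : A.curve e.1 e.2.1 e.2.2 t₀ = A.curve e₀.1 e₀.2.1 e₀.2.2 t₀ := by
        rw [← toDisc_fromDisc (hlt e t₀ hm), ← toDisc_fromDisc (hlt e₀ t₀ ht₀m)]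
        exact congrArg toDisc hγ
      rw [hk', hj] at h1
      have h2 := A.injective_curve _ _ t₀ ⟨ht₀.1, ht₀.2.trans_le (min_le_left _ _)⟩ h1
      exact Prod.ext hk' (Prod.ext hj h2)
    · left
      intro hm
      have h1 : A.t e₀.2.1.castSucc < A.t e.2.1.succ :=
        ht₀.1.trans_le (hm.2.trans (min_le_left _ _))
      have h2 : A.t e.2.1.castSucc < A.t e₀.2.1.succ :=
        hm.1.trans_lt (ht₀.2.trans_le (min_le_left _ _))
      have h3 := A.strictMono_t.lt_iff_lt.1 h1
      have h4 := A.strictMono_t.lt_iff_lt.1 h2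
      simp only [Fin.lt_def, Fin.val_castSucc, Fin.val_succ] at h3 h4
      exact hj (Fin.ext (by omega))
  · simp only [hΦs, hΦt]
    exact (hF (axisDir e₀.1) (A.t e₀.2.1.castSucc) (β e₀.2.1) (γ e₀) (axisDir_pow_four _)
      (A.t_nonneg _) (hβ _).le (hβT _) (hγc e₀) (hPγ e₀) (hγreg e₀)).2 ht₀ rfl rfl

/-- Arcs with common ends have equal increments for every potential, contradicting concentration on
one of them. This excludes multiple edges, so a simple graph records all arcs. -/
theorem eq_of_src_eq_of_tgt_eq {e f : A.Edge} (hs : A.src e = A.src f) (ht : A.tgt e = A.tgt f) :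
    e = f := by
  by_contra hne
  obtain ⟨Φ, h0, c, hc, h1⟩ := A.exists_potential f
  have := h0 e hne
  rw [hs, ht] at this
  exact hc (tendsto_nhds_unique h1 this)

end ArcSystem

/-! ### The graph and its drawing -/

theorem IsArcBetween.symm {a b : ℂ} {A : Set ℂ} (h : IsArcBetween a b A) :
    IsArcBetween b a A := by
  obtain ⟨γ, hc, hi, h0, h1, hr⟩ := h
  have hσ : Function.Involutive unitInterval.symm := unitInterval.symm_symm
  refine ⟨γ ∘ unitInterval.symm, hc.comp unitInterval.continuous_symm,
    hi.comp hσ.injective, by simp [h1], by simp [h0], ?_⟩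
  rw [hσ.surjective.range_comp, hr]

theorem isArcBetween_image_Icc {f : ℝ → ℂ} {a b : ℝ} (hab : a < b)
    (hf : ContinuousOn f (Icc a b)) (hinj : InjOn f (Icc a b)) :
    IsArcBetween (f a) (f b) (f '' Icc a b) := by
  let e := iccHomeoI a b hab
  have hfc : Continuous fun x : Icc a b => f x := continuousOn_iff_continuous_domRestrict.1 hf
  refine ⟨fun s => f (e.symm s), hfc.comp e.symm.continuous, fun s s' h => ?_, ?_, ?_, ?_⟩
  · exact e.symm.injective (Subtype.ext (hinj (e.symm s).2 (e.symm s').2 h))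
  · simp [e]
  · simp [e]
  · have : (fun s => f (e.symm s)) = (fun x : Icc a b => f x) ∘ e.symm := rfl
    rw [this, e.symm.surjective.range_comp]
    ext x
    simp

namespace ArcSystem

variable {P : ℂ[X]} (A : ArcSystem P)

theorem src_ne_tgt (e : A.Edge) : A.src e ≠ A.tgt e := by
  intro h
  have := congrArg (fun v => ‖discMap P v‖) h
  simp only [norm_discMap_src, norm_discMap_tgt] at this
  exact (A.t_castSucc_lt_succ _).ne this

/-- The norm of `discMap` strictly increases along every arc. -/
theorem not_swapped {e f : A.Edge} (h1 : A.src e = A.tgt f) (h2 : A.tgt e = A.src f) : False := by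
  have h1 := congrArg (fun v => ‖discMap P v‖) h1
  have h2 := congrArg (fun v => ‖discMap P v‖) h2
  simp only [norm_discMap_src, norm_discMap_tgt] at h1 h2
  have := A.t_castSucc_lt_succ e.2.1
  have := A.t_castSucc_lt_succ f.2.1
  linarith

/-- The vertices of the diagram. -/
noncomputable def nodes : Finset ℂ := Finset.univ.image A.src ∪ Finset.univ.image A.tgt

theorem src_mem (e : A.Edge) : A.src e ∈ A.nodes :=
  Finset.mem_union_left _ (Finset.mem_image_of_mem _ (Finset.mem_univ e))

theorem tgt_mem (e : A.Edge) : A.tgt e ∈ A.nodes :=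
  Finset.mem_union_right _ (Finset.mem_image_of_mem _ (Finset.mem_univ e))

/-- The starting point of an arc, as a vertex. -/
noncomputable def srcNode (e : A.Edge) : A.nodes := ⟨A.src e, A.src_mem e⟩

/-- The end point of an arc, as a vertex. -/
noncomputable def tgtNode (e : A.Edge) : A.nodes := ⟨A.tgt e, A.tgt_mem e⟩

theorem exists_discMap_eq_of_mem {v : ℂ} (hv : v ∈ A.nodes) :
    ∃ k m, discMap P v = axisDir k * A.t m := by
  rcases Finset.mem_union.1 hv with h | h <;> obtain ⟨e, -, rfl⟩ := Finset.mem_image.1 h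
  · exact ⟨_, _, A.discMap_src e⟩
  · exact ⟨_, _, A.discMap_tgt e⟩

/-- Local degrees are positive, so some arc ends at each point over a break value. No segment starts
at the last break point, hence the separate case. -/
theorem mem_nodes (hP : 0 < P.natDegree) {v : ℂ} {k : Fin 4} {m : Fin (A.M + 2)}
    (h : discMap P v = axisDir k * A.t m) : v ∈ A.nodes := by
  induction m using Fin.lastCases with
  | last =>
    obtain ⟨i, hi⟩ := A.exists_curve_eq hP k (Fin.last A.M)
      (right_mem_Icc.2 (A.t_castSucc_lt_succ _).le) h
    exact hi ▸ A.tgt_mem (k, Fin.last A.M, i)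
  | cast j =>
    obtain ⟨i, hi⟩ := A.exists_curve_eq hP k j (left_mem_Icc.2 (A.t_castSucc_lt_succ _).le) h
    exact hi ▸ A.src_mem (k, j, i)

/-- The graph of the diagram. -/
noncomputable def graph : SimpleGraph A.nodes where
  Adj u v := ∃ e, (A.srcNode e = u ∧ A.tgtNode e = v) ∨ (A.srcNode e = v ∧ A.tgtNode e = u)
  symm := ⟨fun _ _ ⟨e, he⟩ => ⟨e, he.symm⟩⟩
  loopless := ⟨by
    rintro u ⟨e, ⟨h1, h2⟩ | ⟨h1, h2⟩⟩ <;>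
    exact A.src_ne_tgt e (congrArg Subtype.val (h1.trans h2.symm))⟩

theorem graph_adj (e : A.Edge) : A.graph.Adj (A.srcNode e) (A.tgtNode e) :=
  ⟨e, Or.inl ⟨rfl, rfl⟩⟩

theorem mem_edgeSet_iff {x : Sym2 A.nodes} :
    x ∈ A.graph.edgeSet ↔ ∃ e, s(A.srcNode e, A.tgtNode e) = x := by
  induction x with
  | _ u v =>
    rw [SimpleGraph.mem_edgeSet]
    simp only [graph, Sym2.eq_iff]

theorem edge_injective : Function.Injective fun e => s(A.srcNode e, A.tgtNode e) := by
  intro e f h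
  rcases Sym2.eq_iff.1 h with ⟨h1, h2⟩ | ⟨h1, h2⟩
  · exact A.eq_of_src_eq_of_tgt_eq (congrArg Subtype.val h1) (congrArg Subtype.val h2)
  · exact (A.not_swapped (congrArg Subtype.val h1) (congrArg Subtype.val h2)).elim

/-- The image of an arc. -/
noncomputable def arcSet (e : A.Edge) : Set ℂ :=
  A.curve e.1 e.2.1 e.2.2 '' Icc (A.t e.2.1.castSucc) (A.t e.2.1.succ)

/-- The arc drawing an edge of the graph. -/
noncomputable def arc (x : Sym2 A.nodes) : Set ℂ :=
  ⋃ e, ⋃ _ : s(A.srcNode e, A.tgtNode e) = x, A.arcSet e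

theorem arc_mk (e : A.Edge) : A.arc s(A.srcNode e, A.tgtNode e) = A.arcSet e := by
  ext z
  simp only [arc, mem_iUnion, exists_prop]
  constructor
  · rintro ⟨f, hf, hz⟩
    rwa [← A.edge_injective hf]
  · exact fun h => ⟨e, rfl, h⟩

/-- The parameter is recovered as the norm of `discMap`, so the curve is injective. -/
theorem isArcBetween_arcSet (e : A.Edge) : IsArcBetween (A.src e) (A.tgt e) (A.arcSet e) := by
  refine isArcBetween_image_Icc (A.t_castSucc_lt_succ _) (A.continuousOn_curve _ _ _) ?_
  intro s hs s' hs' h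
  rw [← A.norm_discMap_curve e.1 e.2.1 e.2.2 hs, ← A.norm_discMap_curve e.1 e.2.1 e.2.2 hs', h]

theorem t_eq_of_mem_Icc {j : Fin (A.M + 1)} {m : Fin (A.M + 2)}
    (h : A.t m ∈ Icc (A.t j.castSucc) (A.t j.succ)) : m = j.castSucc ∨ m = j.succ := by
  have h1 := A.strictMono_t.le_iff_le.1 h.1
  have h2 := A.strictMono_t.le_iff_le.1 h.2
  simp only [Fin.le_def, Fin.ext_iff, Fin.val_castSucc, Fin.val_succ] at h1 h2 ⊢
  omega

theorem arcSet_inter_nodes (e : A.Edge) :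
    A.arcSet e ∩ (A.nodes : Set ℂ) = {A.src e, A.tgt e} := by
  ext z
  simp only [mem_inter_iff, Finset.mem_coe, mem_insert_iff, mem_singleton_iff]
  constructor
  · rintro ⟨⟨s, hs, rfl⟩, hz⟩
    obtain ⟨k, m, hm⟩ := A.exists_discMap_eq_of_mem hz
    have h1 := A.norm_discMap_curve e.1 e.2.1 e.2.2 hs
    rw [hm, norm_mul, norm_axisDir, one_mul, Complex.norm_of_nonneg (A.t_nonneg m)] at h1
    subst h1
    rcases A.t_eq_of_mem_Icc hs with rfl | rfl
    · exact Or.inl rfl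
    · exact Or.inr rfl
  · rintro (rfl | rfl)
    · exact ⟨⟨_, left_mem_Icc.2 (A.t_castSucc_lt_succ _).le, rfl⟩, A.src_mem e⟩
    · exact ⟨⟨_, right_mem_Icc.2 (A.t_castSucc_lt_succ _).le, rfl⟩, A.tgt_mem e⟩

/-- A common point has the same parameter on both arcs. If it is interior, the segment and the
half-axis agree too, and distinct roots there do not meet. -/
theorem arcSet_inter_arcSet {e f : A.Edge} (hef : e ≠ f) :
    A.arcSet e ∩ A.arcSet f ⊆ (A.nodes : Set ℂ) := by
  rintro _ ⟨⟨s, hs, rfl⟩, ⟨s', hs', h⟩⟩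
  have hss : s' = s := by
    rw [← A.norm_discMap_curve _ _ _ hs, ← h, A.norm_discMap_curve _ _ _ hs']
  subst hss
  rcases eq_endpoints_or_mem_Ioo_of_mem_Icc hs with rfl | rfl | hs1
  · exact A.src_mem e
  · exact A.tgt_mem e
  rcases eq_endpoints_or_mem_Ioo_of_mem_Icc hs' with rfl | rfl | hs2
  · rw [← h]; exact A.src_mem f
  · rw [← h]; exact A.tgt_mem f
  exfalso
  obtain ⟨k, j, i⟩ := e
  obtain ⟨k', j', i'⟩ := f
  have h3 := A.strictMono_t.lt_iff_lt.1 (hs1.1.trans hs2.2)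
  have h4 := A.strictMono_t.lt_iff_lt.1 (hs2.1.trans hs1.2)
  simp only [Fin.lt_def, Fin.val_castSucc, Fin.val_succ] at h3 h4
  obtain rfl : j = j' := Fin.ext (by omega)
  have h5 := congrArg (discMap P) h
  have hs0 := A.t_nonneg j.castSucc
  rw [A.discMap_curve _ _ _ _ hs, A.discMap_curve _ _ _ _ hs',
    axisDir_mul_eq_iff (hs0.trans hs.1) (hs0.trans hs.1)] at h5
  obtain rfl := h5.2.resolve_left (hs0.trans_lt hs1.1).ne'
  exact hef (congrArg (fun a => (k', j, a)) (A.injective_curve _ _ _ hs1 h.symm))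

/-! ### Valencies -/

/-- The degree of a vertex, as the number of arcs starting or ending there. -/
theorem ncard_neighborSet (v : A.nodes) : (A.graph.neighborSet v).ncard =
    (Finset.univ.filter fun e => A.src e = v).card +
      (Finset.univ.filter fun e => A.tgt e = v).card := by
  have h : A.graph.neighborSet v = A.tgtNode '' {e | A.src e = v} ∪
      A.srcNode '' {e | A.tgt e = v} := by
    ext u
    simp only [SimpleGraph.mem_neighborSet, graph, mem_union, mem_image, mem_ofPred_eq]
    constructor
    · rintro ⟨e, ⟨h1, h2⟩ | ⟨h1, h2⟩⟩
      · exact Or.inl ⟨e, congrArg Subtype.val h1, h2⟩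
      · exact Or.inr ⟨e, congrArg Subtype.val h2, h1⟩
    · rintro (⟨e, h1, h2⟩ | ⟨e, h1, h2⟩)
      · exact ⟨e, Or.inl ⟨Subtype.ext h1, h2⟩⟩
      · exact ⟨e, Or.inr ⟨h2, Subtype.ext h1⟩⟩
  have hd : Disjoint (A.tgtNode '' {e | A.src e = v}) (A.srcNode '' {e | A.tgt e = v}) := by
    rw [Set.disjoint_left]
    rintro _ ⟨e, he, rfl⟩ ⟨f, hf, hef⟩
    exact A.not_swapped (Eq.trans he (Eq.symm hf)) (congrArg Subtype.val hef).symm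
  rw [h, ncard_union_eq hd (toFinite _) (toFinite _), InjOn.ncard_image, InjOn.ncard_image,
    ← ncard_coe_finset, ← ncard_coe_finset]
  · simp
  · intro e he f hf hef
    exact A.eq_of_src_eq_of_tgt_eq (congrArg Subtype.val hef) (Eq.trans he (Eq.symm hf))
  · intro e he f hf hef
    exact A.eq_of_src_eq_of_tgt_eq (Eq.trans he (Eq.symm hf)) (congrArg Subtype.val hef)

/-- Each pair of a half-axis and a segment starting over `v` contributes `discMult P v` arcs. -/
theorem card_src (v : ℂ) : (Finset.univ.filter fun e => A.src e = v).card =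
    (Finset.univ.filter fun q : Fin 4 × Fin (A.M + 1) =>
      discMap P v = axisDir q.1 * A.t q.2.castSucc).card * discMult P v := by
  have key : ∀ k j, (∑ i, if A.src (k, j, i) = v then 1 else 0) =
      if discMap P v = axisDir k * A.t j.castSucc then discMult P v else 0 := by
    intro k j
    split_ifs with h
    · rw [← Finset.card_filter]
      exact A.card_curve k j _ (left_mem_Icc.2 (A.t_castSucc_lt_succ _).le) v h
    · refine Finset.sum_eq_zero fun i _ => if_neg ?_
      rintro rfl
      exact h (A.discMap_src (k, j, i))
  rw [Finset.card_filter, Finset.card_filter, Finset.sum_mul, Fintype.sum_prod_type,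
    Fintype.sum_prod_type]
  refine Finset.sum_congr rfl fun k _ => ?_
  rw [Fintype.sum_prod_type]
  refine Finset.sum_congr rfl fun j _ => ?_
  rw [key, ite_mul, one_mul, zero_mul]

theorem card_tgt (v : ℂ) : (Finset.univ.filter fun e => A.tgt e = v).card =
    (Finset.univ.filter fun q : Fin 4 × Fin (A.M + 1) =>
      discMap P v = axisDir q.1 * A.t q.2.succ).card * discMult P v := by
  have key : ∀ k j, (∑ i, if A.tgt (k, j, i) = v then 1 else 0) =
      if discMap P v = axisDir k * A.t j.succ then discMult P v else 0 := by
    intro k j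
    split_ifs with h
    · rw [← Finset.card_filter]
      exact A.card_curve k j _ (right_mem_Icc.2 (A.t_castSucc_lt_succ _).le) v h
    · refine Finset.sum_eq_zero fun i _ => if_neg ?_
      rintro rfl
      exact h (A.discMap_tgt (k, j, i))
  rw [Finset.card_filter, Finset.card_filter, Finset.sum_mul, Fintype.sum_prod_type,
    Fintype.sum_prod_type]
  refine Finset.sum_congr rfl fun k _ => ?_
  rw [Fintype.sum_prod_type]
  refine Finset.sum_congr rfl fun j _ => ?_
  rw [key, ite_mul, one_mul, zero_mul]

theorem discMap_eq_iff {k k' : Fin 4} {m m' : Fin (A.M + 2)} :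
    axisDir k * (A.t m : ℂ) = axisDir k' * A.t m' ↔ m = m' ∧ (m = 0 ∨ k = k') := by
  rw [axisDir_mul_eq_iff (A.t_nonneg _) (A.t_nonneg _), A.strictMono_t.injective.eq_iff,
    t_eq_zero_iff]

/-- The origin starts one segment on each of the four half-axes and ends none. -/
theorem ncard_neighborSet_of_eq_zero (v : A.nodes) (h : discMap P v = 0) :
    (A.graph.neighborSet v).ncard = 4 * discMult P v := by
  have h0 : discMap P (v : ℂ) = axisDir 0 * A.t 0 := by rw [h, A.t_zero]; simp
  rw [ncard_neighborSet, card_src, card_tgt]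
  simp only [h0, discMap_eq_iff]
  have h1 : (Finset.univ.filter fun q : Fin 4 × Fin (A.M + 1) =>
      0 = q.2.castSucc ∧ (True ∨ 0 = q.1)) =
      Finset.univ ×ˢ {0} := by
    ext ⟨k, j⟩
    simp [eq_comm]
  have h2 : (Finset.univ.filter fun q : Fin 4 × Fin (A.M + 1) =>
      0 = q.2.succ ∧ (True ∨ 0 = q.1)) = ∅ := by
    ext ⟨k, j⟩
    simp [(Fin.succ_ne_zero j).symm]
  rw [h1, h2]
  simp

/-- A nonzero inner break value lies on one half-axis, between two segments. -/
theorem ncard_neighborSet_of_mid (v : A.nodes) {k : Fin 4} {m : Fin (A.M + 2)} (h0 : m ≠ 0)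
    (h1 : m ≠ Fin.last _) (h : discMap P v = axisDir k * A.t m) :
    (A.graph.neighborSet v).ncard = 2 * discMult P v := by
  rw [ncard_neighborSet, card_src, card_tgt]
  simp only [h, discMap_eq_iff]
  have e1 : (Finset.univ.filter fun q : Fin 4 × Fin (A.M + 1) =>
      m = q.2.castSucc ∧ (m = 0 ∨ k = q.1)) = {(k, m.castPred h1)} := by
    ext ⟨k', j⟩
    simp only [h0, Finset.mem_filter, Finset.mem_univ, true_and, false_or, Finset.mem_singleton,
      Prod.mk.injEq]
    constructor
    · rintro ⟨rfl, rfl⟩; simp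
    · rintro ⟨rfl, rfl⟩; simp
  have e2 : (Finset.univ.filter fun q : Fin 4 × Fin (A.M + 1) =>
      m = q.2.succ ∧ (m = 0 ∨ k = q.1)) = {(k, m.pred h0)} := by
    ext ⟨k', j⟩
    simp only [h0, Finset.mem_filter, Finset.mem_univ, true_and, false_or, Finset.mem_singleton,
      Prod.mk.injEq]
    constructor
    · rintro ⟨rfl, rfl⟩; simp
    · rintro ⟨rfl, rfl⟩; simp
  rw [e1, e2]
  simp
  ring

theorem ncard_neighborSet_of_last (v : A.nodes) {k : Fin 4}
    (h : discMap P v = axisDir k * A.t (Fin.last _)) :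
    (A.graph.neighborSet v).ncard = discMult P v := by
  have h0 : Fin.last (A.M + 1) ≠ 0 := Fin.last_pos.ne'
  rw [ncard_neighborSet, card_src, card_tgt]
  simp only [h, discMap_eq_iff]
  have e1 : (Finset.univ.filter fun q : Fin 4 × Fin (A.M + 1) =>
      Fin.last (A.M + 1) = q.2.castSucc ∧ (Fin.last (A.M + 1) = 0 ∨ k = q.1)) = ∅ := by
    ext ⟨k', j⟩
    simp [(Fin.castSucc_ne_last j).symm]
  have e2 : (Finset.univ.filter fun q : Fin 4 × Fin (A.M + 1) =>
      Fin.last (A.M + 1) = q.2.succ ∧ (Fin.last (A.M + 1) = 0 ∨ k = q.1)) =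
      {(k, Fin.last A.M)} := by
    ext ⟨k', j⟩
    simp only [h0, Finset.mem_filter, Finset.mem_univ, true_and, false_or, Finset.mem_singleton,
      Prod.mk.injEq]
    rw [← Fin.succ_last, Fin.succ_inj]
    tauto
  rw [e1, e2]
  simp

/-! ### Absence of cycles -/

theorem isAcyclic_graph : A.graph.IsAcyclic := by
  rw [SimpleGraph.isAcyclic_iff_forall_isBridge]
  intro x hx
  obtain ⟨e₀, rfl⟩ := A.mem_edgeSet_iff.1 hx
  obtain ⟨Φ, h0, c, hc, h1⟩ := A.exists_potential e₀
  rw [SimpleGraph.isBridge_iff]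
  rintro ⟨w⟩
  -- Along a walk avoiding `e₀` the increments telescope, and each step tends to zero.
  have key : ∀ {u v : A.nodes} (_ : (A.graph.deleteEdges {s(A.srcNode e₀, A.tgtNode e₀)}).Walk u v),
      Tendsto (fun N => Φ N v - Φ N u) atTop (𝓝 0) := by
    intro u v p
    induction p with
    | nil => simp
    | @cons u v w h p ih =>
      have hstep : Tendsto (fun N => Φ N v - Φ N u) atTop (𝓝 0) := by
        rw [SimpleGraph.deleteEdges_adj] at h
        obtain ⟨⟨e, he⟩, hne⟩ := h
        have hee : e ≠ e₀ := by
          rintro rfl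
          refine hne ?_
          rw [mem_singleton_iff, eq_comm, Sym2.eq_iff]
          exact he
        rcases he with ⟨rfl, rfl⟩ | ⟨rfl, rfl⟩
        · exact h0 e hee
        · simpa [srcNode, tgtNode] using (h0 e hee).neg
      simpa using ih.add hstep
  exact hc (tendsto_nhds_unique h1 (key w))

end ArcSystem

/-! ### The chord diagram and its properties -/

namespace ArcSystem

variable {P : ℂ[X]} (A : ArcSystem P)

theorem node_cases (v : A.nodes) :
    (discMap P v = 0 ∧ (A.graph.neighborSet v).ncard = 4 * discMult P v) ∨
    (0 < ‖discMap P v‖ ∧ ‖discMap P v‖ < 1 ∧ (A.graph.neighborSet v).ncard = 2 * discMult P v) ∨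
    (∃ k, discMap P v = axisDir k ∧ (A.graph.neighborSet v).ncard = discMult P v) := by
  obtain ⟨k, m, h⟩ := A.exists_discMap_eq_of_mem v.2
  by_cases h0 : m = 0
  · have hv : discMap P (v : ℂ) = 0 := by rw [h, h0, A.t_zero]; simp
    exact Or.inl ⟨hv, A.ncard_neighborSet_of_eq_zero v hv⟩
  by_cases h1 : m = Fin.last _
  · subst h1
    exact Or.inr (Or.inr ⟨k, by rw [h, A.t_last]; simp, A.ncard_neighborSet_of_last v h⟩)
  · refine Or.inr (Or.inl ?_)
    rw [h, norm_mul, norm_axisDir, one_mul, Complex.norm_of_nonneg (A.t_nonneg m)]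
    refine ⟨(A.t_nonneg m).lt_of_ne' (mt A.t_eq_zero_iff.1 h0),
      (A.t_le_one m).lt_of_ne (mt A.t_eq_one_iff.1 h1), ?_⟩
    exact A.ncard_neighborSet_of_mid v h0 h1 h

/-- Inside the disc the valency is `4` or `2` times a positive local degree, so it is even and not
one; on the circle the local degree is one. -/
theorem norm_lt_one_or_isLeaf (hP : 0 < P.natDegree) (v : A.nodes) :
    (‖(v : ℂ)‖ < 1 ∧ (A.graph.neighborSet v).ncard ≠ 1 ∧ Even (A.graph.neighborSet v).ncard) ∨
    (‖(v : ℂ)‖ = 1 ∧ (A.graph.neighborSet v).ncard = 1 ∧ ∃ k, discMap P v = axisDir k) := by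
  have hP0 : P ≠ 0 := by rintro rfl; simp at hP
  have hm := discMult_pos hP v
  rcases A.node_cases v with ⟨h, hc⟩ | ⟨-, h, hc⟩ | ⟨k, h, hc⟩
  · exact Or.inl ⟨norm_lt_one_of_norm_discMap_lt hP0 (by simp [h]), by omega,
      ⟨2 * discMult P v, by omega⟩⟩
  · exact Or.inl ⟨norm_lt_one_of_norm_discMap_lt hP0 h, by omega, ⟨discMult P v, by omega⟩⟩
  · have hv : ‖(v : ℂ)‖ = 1 := norm_eq_one_of_norm_discMap hP (by rw [h, norm_axisDir])
    exact Or.inr ⟨hv, by rw [hc, discMult, if_neg hv.ge.not_gt], k, h⟩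

/-- The chord diagram of a polynomial. -/
noncomputable def diagram (hP : 0 < P.natDegree) : ChordDiagram where
  nodes := A.nodes
  graph := A.graph
  arc := A.arc
  isArc := by
    rintro u v ⟨e, ⟨rfl, rfl⟩ | ⟨rfl, rfl⟩⟩
    · rw [arc_mk]; exact A.isArcBetween_arcSet e
    · rw [Sym2.eq_swap, arc_mk]; exact (A.isArcBetween_arcSet e).symm
  arc_inter_nodes := by
    rintro u v ⟨e, ⟨rfl, rfl⟩ | ⟨rfl, rfl⟩⟩
    · rw [arc_mk]; exact A.arcSet_inter_nodes e
    · rw [Sym2.eq_swap, arc_mk, pair_comm]; exact A.arcSet_inter_nodes e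
  arc_inter_arc := by
    intro x hx y hy hxy
    obtain ⟨e, rfl⟩ := A.mem_edgeSet_iff.1 hx
    obtain ⟨f, rfl⟩ := A.mem_edgeSet_iff.1 hy
    rw [arc_mk, arc_mk]
    exact A.arcSet_inter_arcSet fun h => hxy (by rw [h])
  not_isolated := by
    rintro ⟨v, hv⟩
    rcases Finset.mem_union.1 hv with h | h <;> obtain ⟨e, -, rfl⟩ := Finset.mem_image.1 h
    · exact ⟨_, A.graph_adj e⟩
    · exact ⟨_, (A.graph_adj e).symm⟩
  leaf_mem_circle := by
    intro v hv
    rcases A.norm_lt_one_or_isLeaf hP v with h | h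
    · exact absurd hv h.2.1
    · exact h.1
  inner_mem_disc := by
    intro v hv
    rcases A.norm_lt_one_or_isLeaf hP v with h | h
    · exact h.1
    · exact absurd h.2.1 hv
  arc_mem_disc := by
    intro x hx z hz hzn
    obtain ⟨e, rfl⟩ := A.mem_edgeSet_iff.1 hx
    rw [arc_mk] at hz
    obtain ⟨s, hs, rfl⟩ := hz
    refine norm_lt_one_of_norm_discMap_lt (A.ne_zero_of_edge e) ?_
    rw [A.norm_discMap_curve _ _ _ hs]
    refine (hs.2.trans (A.t_le_one _)).lt_of_ne ?_
    rintro rfl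
    have : A.t e.2.1.succ = 1 := le_antisymm (A.t_le_one _) hs.2
    refine hzn ?_
    rw [← this]
    exact A.tgt_mem e

theorem isLeaf_iff (hP : 0 < P.natDegree) (v : A.nodes) :
    (A.diagram hP).IsLeaf v ↔ ∃ k, discMap P v = axisDir k := by
  rcases A.norm_lt_one_or_isLeaf hP v with h | h
  · refine iff_of_false h.2.1 ?_
    rintro ⟨k, hk⟩
    have := norm_discMap_lt_one (P := P) h.1
    rw [hk, norm_axisDir] at this
    exact this.false
  · exact iff_of_true h.2.1 h.2.2

theorem eval_fromDisc_eq_of_mem_arcSet {e : A.Edge} {z : ℂ} (hz : z ∈ A.arcSet e)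
    (h1 : ‖z‖ < 1) : ∃ r : ℝ, P.eval (fromDisc z) = axisDir e.1 * r := by
  obtain ⟨s, hs, rfl⟩ := hz
  have hs1 : s < 1 := by
    rw [← A.norm_discMap_curve _ _ _ hs]; exact norm_discMap_lt_one h1
  exact ⟨_, eval_fromDisc_of_discMap (A.ne_zero_of_edge e) (norm_axisDir _)
    ((A.t_nonneg _).trans hs.1) hs1 (A.discMap_curve _ _ _ _ hs)⟩

theorem arcSet_subset_level (e : A.Edge) :
    A.arcSet e ∩ Metric.ball 0 1 ⊆ toDisc '' reLevel P ∨
      A.arcSet e ∩ Metric.ball 0 1 ⊆ toDisc '' imLevel P := by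
  rcases axisDir_mul_re_or_im e.1 with h | h
  · left
    rintro z ⟨hz, hz1⟩
    have hz1 := mem_ball_zero_iff.1 hz1
    obtain ⟨r, hr⟩ := A.eval_fromDisc_eq_of_mem_arcSet hz hz1
    exact ⟨fromDisc z, (congrArg Complex.re hr).trans (h r), toDisc_fromDisc hz1⟩
  · right
    rintro z ⟨hz, hz1⟩
    have hz1 := mem_ball_zero_iff.1 hz1
    obtain ⟨r, hr⟩ := A.eval_fromDisc_eq_of_mem_arcSet hz hz1
    exact ⟨fromDisc z, (congrArg Complex.im hr).trans (h r), toDisc_fromDisc hz1⟩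

theorem exists_mem_Icc {s : ℝ} (h0 : 0 ≤ s) (h1 : s ≤ 1) :
    ∃ j : Fin (A.M + 1), s ∈ Icc (A.t j.castSucc) (A.t j.succ) := by
  by_contra! h
  have key : ∀ m : Fin (A.M + 2), A.t m ≤ s := by
    intro m
    induction m using Fin.induction with
    | zero => rw [A.t_zero]; exact h0
    | succ j ih =>
      by_contra! hlt
      exact h j ⟨ih, hlt.le⟩
  have hs : s = 1 := le_antisymm h1 (A.t_last ▸ key _)
  exact h (Fin.last _) ⟨key _, by rw [Fin.succ_last, A.t_last, hs]⟩

theorem diagram_represents (hP : 0 < P.natDegree) : (A.diagram hP).Represents P := by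
  have hsupp : ∀ z, z ∈ (A.diagram hP).support ↔ ∃ e, z ∈ A.arcSet e := by
    intro z
    constructor
    · rintro (hz | hz)
      · rcases Finset.mem_union.1 (Finset.mem_coe.1 hz) with h | h <;>
          obtain ⟨e, -, rfl⟩ := Finset.mem_image.1 h
        · exact ⟨e, _, left_mem_Icc.2 (A.t_castSucc_lt_succ _).le, rfl⟩
        · exact ⟨e, _, right_mem_Icc.2 (A.t_castSucc_lt_succ _).le, rfl⟩
      · obtain ⟨x, hx, hz⟩ := mem_iUnion₂.1 hz
        obtain ⟨e, rfl⟩ := A.mem_edgeSet_iff.1 hx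
        exact ⟨e, A.arc_mk e ▸ hz⟩
    · rintro ⟨e, he⟩
      exact Or.inr (mem_iUnion₂.2 ⟨_, A.graph_adj e, (A.arc_mk e).symm ▸ he⟩)
  refine ⟨?_, ?_⟩
  · ext v
    rw [mem_inter_iff, hsupp, mem_ball_zero_iff]
    constructor
    · rintro ⟨z, hz, rfl⟩
      refine ⟨?_, norm_toDisc_lt_one z⟩
      obtain ⟨k, r, hr, hzr⟩ := exists_axisDir_mul_of_mem_axes (w := P.eval z) hz
      have hr1 : 0 < 1 + r := by positivity
      -- A web point whose value has modulus `r` lies over the parameter `r / (1 + r)`.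
      have h0 : 0 ≤ r / (1 + r) := by positivity
      have h1 : r / (1 + r) < 1 := by rw [div_lt_one hr1]; linarith
      have h2 : r / (1 + r) / (1 - r / (1 + r)) = r := by field_simp; ring
      obtain ⟨j, hj⟩ := A.exists_mem_Icc h0 h1.le
      obtain ⟨i, hi⟩ := A.exists_curve_eq hP k j hj
        (discMap_toDisc (norm_axisDir k) h0 h1 (by rw [h2, hzr]))
      exact ⟨(k, j, i), _, hj, hi⟩
    · rintro ⟨⟨e, he⟩, hv⟩
      have hm : v ∈ A.arcSet e ∩ Metric.ball 0 1 := ⟨he, mem_ball_zero_iff.2 hv⟩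
      rcases A.arcSet_subset_level e with h | h
      · exact image_mono subset_union_left (h hm)
      · exact image_mono subset_union_right (h hm)
  · intro x hx
    obtain ⟨e, rfl⟩ := A.mem_edgeSet_iff.1 hx
    have := A.arcSet_subset_level e
    rw [← A.arc_mk e] at this
    exact this

/-- Leaves are the far ends of the arcs over the last segments: four half-axes, `n` arcs each, no
two sharing an end. -/
theorem ncard_isLeaf (hP : 0 < P.natDegree) :
    {v : (A.diagram hP).nodes | (A.diagram hP).IsLeaf v}.ncard = 4 * P.natDegree := by
  let f : Fin 4 × Fin P.natDegree → A.nodes := fun q => A.tgtNode (q.1, Fin.last _, q.2)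
  have hfd : ∀ q, discMap P (f q) = axisDir q.1 := fun q => by
    have := A.discMap_tgt (q.1, Fin.last _, q.2)
    rw [Fin.succ_last, A.t_last, Complex.ofReal_one, mul_one] at this
    exact this
  have hf : Function.Injective f := by
    intro q q' h
    have hn : ‖(f q : ℂ)‖ = 1 :=
      norm_eq_one_of_norm_discMap hP (by rw [hfd, norm_axisDir])
    have := A.eq_of_tgt_eq_of_norm (congrArg Subtype.val h) hn
    simp only [Prod.mk.injEq, true_and] at this
    exact Prod.ext this.1 this.2
  have hr : {v : (A.diagram hP).nodes | (A.diagram hP).IsLeaf v} = f '' univ := by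
    ext v
    rw [mem_ofPred_eq, A.isLeaf_iff hP v, image_univ]
    constructor
    · rintro ⟨k, hk⟩
      obtain ⟨i, hi⟩ := A.exists_curve_eq hP k (Fin.last A.M)
        (right_mem_Icc.2 (A.t_castSucc_lt_succ _).le) (x := v)
        (by rw [Fin.succ_last, A.t_last, Complex.ofReal_one, mul_one]; exact hk)
      exact ⟨(k, i), Subtype.ext hi⟩
    · rintro ⟨q, rfl⟩
      exact ⟨q.1, hfd q⟩
  have hc : (f '' univ).ncard = 4 * P.natDegree := by
    rw [ncard_image_of_injective _ hf, ncard_univ]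
    simp
  exact (congrArg ncard hr).trans hc

/-- For monic `P` the boundary map is `w ↦ w ^ n`, and the leaves lie over the fourth roots of
unity. -/
theorem exists_isLeaf_iff_of_monic (hP : 0 < P.natDegree) (hm : P.Monic) (w : ℂ) :
    (∃ v : (A.diagram hP).nodes, (A.diagram hP).IsLeaf v ∧ (v : ℂ) = w) ↔
      w ^ (4 * P.natDegree) = 1 := by
  have hcirc : ∀ x : ℂ, ‖x‖ = 1 → discMap P x = x ^ P.natDegree := fun x hx => by
    rw [discMap_of_norm_eq_one hx, hm.leadingCoeff]; simp
  constructor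
  · rintro ⟨v, hv, rfl⟩
    obtain ⟨k, hk⟩ := (A.isLeaf_iff hP v).1 hv
    have hn : ‖(v : ℂ)‖ = 1 := norm_eq_one_of_norm_discMap hP (by rw [hk, norm_axisDir])
    rw [hcirc _ hn] at hk
    rw [mul_comm, pow_mul, hk, axisDir_pow_four]
  · intro hw
    have hn : ‖w‖ = 1 := Complex.norm_eq_one_of_pow_eq_one hw (by omega)
    rw [mul_comm, pow_mul] at hw
    obtain ⟨k, hk⟩ := exists_axisDir_of_pow_four hw
    have hd : discMap P w = axisDir k := by rw [hcirc w hn, hk]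
    have hmem : w ∈ A.nodes := A.mem_nodes hP (k := k) (m := Fin.last _)
      (by rw [hd, A.t_last]; simp)
    exact ⟨⟨w, hmem⟩, (A.isLeaf_iff hP ⟨w, hmem⟩).2 ⟨k, hd⟩, rfl⟩

theorem exists_node_of_isRoot (hP : 0 < P.natDegree) {z : ℂ} (hz : P.IsRoot z) :
    ∃ v : (A.diagram hP).nodes, (A.diagram hP).IsInner v ∧ (v : ℂ) = toDisc z ∧
      (A.diagram hP).valency v = 4 * P.rootMultiplicity z := by
  have hd : discMap P (toDisc z) = 0 := by
    have := discMap_toDisc (P := P) (ρ := 1) (z := z) norm_one le_rfl one_pos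
      (by rw [hz.eq_zero]; simp)
    simpa using this
  have hmem : toDisc z ∈ A.nodes := A.mem_nodes hP (k := 0) (m := 0)
    (by rw [hd, A.t_zero]; simp)
  have hmult : discMult P (toDisc z) = P.rootMultiplicity z := by
    rw [discMult, if_pos (norm_toDisc_lt_one z), fromDisc_toDisc, hz.eq_zero, C_0, sub_zero]
  have hval : (A.diagram hP).valency ⟨toDisc z, hmem⟩ = 4 * P.rootMultiplicity z := by
    rw [← hmult]
    exact A.ncard_neighborSet_of_eq_zero ⟨toDisc z, hmem⟩ hd
  refine ⟨⟨toDisc z, hmem⟩, fun h => ?_, rfl, hval⟩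
  rw [ChordDiagram.IsLeaf, hval] at h
  omega

end ArcSystem

theorem mainTheorem6 (n : ℕ) (hn : 1 ≤ n) (P : Polynomial ℂ) (hP : P.natDegree = n) :
    ∃ D : ChordDiagram, D.Represents P ∧
      D.graph.IsAcyclic ∧
      {v : D.nodes | D.IsLeaf v}.ncard = 4 * n ∧
      (P.Monic → ∀ w : ℂ, (∃ v : D.nodes, D.IsLeaf v ∧ (v : ℂ) = w) ↔ w ^ (4 * n) = 1) ∧
      (∀ v : D.nodes, D.IsInner v → Even (D.valency v)) ∧
      (∀ z : ℂ, P.IsRoot z → ∃ v : D.nodes, D.IsInner v ∧ (v : ℂ) = toDisc z ∧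
        D.valency v = 4 * P.rootMultiplicity z) := by
  subst hP
  obtain ⟨A⟩ := nonempty_arcSystem hn
  refine ⟨A.diagram hn, A.diagram_represents hn, A.isAcyclic_graph, A.ncard_isLeaf hn,
    A.exists_isLeaf_iff_of_monic hn, fun v hv => ?_, fun z hz => A.exists_node_of_isRoot hn hz⟩
  rcases A.norm_lt_one_or_isLeaf hn v with h | h
  · exact h.2.2
  · exact absurd h.2.1 hv
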